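/- Let $E$ be a complex Banach space, let $C\in L(E)$ be injective, let $A$ be a closed (not necessarily densely defined) linear operator on $E$, and let $K\in L^1_{loc}([0,\infty))$ be complex-valued and not identically zero (i.e. not a.e. zero). Write $\Theta(t)=\int_0^tK(s)\,ds$. $A$ is a subgenerator of a $K$-convoluted $C$-cosine function $(C_K(t))_{t\ge 0}\subset L(E)$ if $t\mapsto C_K(t)x$ is continuous on $[0,\infty)$ for every $x\in E$ and, for all $t\ge 0$ and $x\in E$, $C_K(t)A\subset AC_K(t)$, $C_K(t)C=CC_K(t)$, $\int_0^t(t-s)C_K(s)x\,ds\in D(A)$ and $A\int_0^t(t-s)C_K(s)x\,ds=C_K(t)x-\Theta(t)Cx$. It is exponentially bounded if $\|C_K(t)\|\le M'e^{\omega t}$, $t\ge0$, for some $M'>0$, $\omega\in\mathbb R$. $A$ is a subgenerator of a $K$-convoluted $C$-semigroup $(S_K(t))_{t\ge 0}$ if the same holds with the last two conditions replaced by $\int_0^tS_K(s)x\,ds\in D(A)$ and $A\int_0^tS_K(s)x\,ds=S_K(t)x-\Theta(t)Cx$. For $0<\alpha\le\pi$ let $\Sigma_\alpha=\{re^{i\theta}: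 r>0,\ |\theta|<\alpha\}$. For $0<\alpha\le\pi/2$, such a semigroup is an exponentially bounded analytic $K$-convoluted $C$-semigroup of angle $\alpha$ if there is an analytic function $\mathbf S_K:\Sigma_\alpha\to L(E)$ with $\mathbf S_K(t)=S_K(t)$ for $t>0$ such that for every $\gamma\in(0,\alpha)$: $\lim_{z\to0,\,z\in\Sigma_\gamma}\mathbf S_K(z)x=0$ for all $x\in E$, and there are $M_\gamma,\omega_\gamma>0$ with $\|\mathbf S_K(z)\|\le M_\gamma e^{\omega_\gamma \mathrm{Re}\,z}$ for $z\in\Sigma_\gamma$. **Theorem.** Assume that for some $M>0$ and $\beta>0$, $|K(t)|\le Me^{\beta t}$ for a.e. $t\ge 0$, and let $A$ be a subgenerator of an exponentially bounded $K$-convoluted $C$-cosine function $(C_K(t))_{t\ge0}$. Put $$K_1(t)=\int_0^\infty\frac{s\,e^{-s^2/4t}}{2\sqrt\pi\,t^{3/2}}K(s)\,ds,\qquad S(t)x=\frac1{\sqrt{\pi t}}\int_0^\infty e^{-s^2/4t}C_K(s)x\,ds,\qquad t>0,\ x\in E,$$ and $S(0)=0$. Then $K_1\in L^1_{loc}([0,\infty))$,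 $K_1$ is not identically zero, and $A$ is a subgenerator of the exponentially bounded analytic $K_1$-convoluted $C$-semigroup $(S(t))_{t\ge0}$ of angle $\pi/2$. -/

import Mathlib

open Set Filter Topology MeasureTheory

noncomputable section

namespace Convoluted

variable {E : Type*} [NormedAddCommGroup E] [NormedSpace ℂ E]

/-- The standing assumption on the convolution function: `K ∈ L¹_loc([0,∞))`, and `K` is not
identically zero as an element of this space. Only values on `[0,∞)` matter. -/
structure IsConvolutionFunction (K : ℝ → ℂ) : Prop where
  locallyIntegrable : LocallyIntegrableOn K (Ici 0) volume
  ne_zero : ¬ (∀ᵐ t ∂(volume.restrict (Ici (0 : ℝ))), K t = 0)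

/-- `Θ(t) = ∫₀ᵗ K(s) ds`. -/
def Theta (K : ℝ → ℂ) (t : ℝ) : ℂ := ∫ s in (0 : ℝ)..t, K s

/-- `T A ⊂ A T` for a bounded operator `T` and an (unbounded) linear operator `A`: for every
`x ∈ D(A)` one has `T x ∈ D(A)` and `A (T x) = T (A x)`. -/
def CommutesWith (T : E →L[ℂ] E) (A : E →ₗ.[ℂ] E) : Prop :=
  ∀ x : A.domain, ∃ h : T x ∈ A.domain, A ⟨T x, h⟩ = T (A x)

/-- A family of bounded operators, indexed by `t ≥ 0`, is strongly continuous. -/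
def StronglyContinuous (T : ℝ → E →L[ℂ] E) : Prop :=
  ∀ x : E, ContinuousOn (fun t => T t x) (Ici 0)

/-- `‖T(t)‖ ≤ M e^{ω t}`, `t ≥ 0`, for some `M > 0` and `ω ∈ ℝ`. -/
def ExponentiallyBounded (T : ℝ → E →L[ℂ] E) : Prop :=
  ∃ M : ℝ, 0 < M ∧ ∃ ω : ℝ, ∀ t : ℝ, 0 ≤ t → ‖T t‖ ≤ M * Real.exp (ω * t)

/-- The closed operator `A` is a subgenerator of the (global) `K`-convoluted `C`-cosine function
`(CK(t))_{t ≥ 0}`. -/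
structure IsCosineFunction (A : E →ₗ.[ℂ] E) (C : E →L[ℂ] E) (K : ℝ → ℂ)
    (CK : ℝ → E →L[ℂ] E) : Prop where
  closed : A.IsClosed
  kernel : IsConvolutionFunction K
  strongly_continuous : StronglyContinuous CK
  commutes_gen : ∀ t : ℝ, 0 ≤ t → CommutesWith (CK t) A
  commutes_C : ∀ t : ℝ, 0 ≤ t → ∀ x : E, CK t (C x) = C (CK t x)
  integral_eq : ∀ t : ℝ, 0 ≤ t → ∀ x : E,
    ∃ h : (∫ s in (0 : ℝ)..t, (t - s) • CK s x) ∈ A.domain,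
      A ⟨∫ s in (0 : ℝ)..t, (t - s) • CK s x, h⟩ = CK t x - Theta K t • C x

/-- The closed operator `A` is a subgenerator of the (global) `K`-convoluted `C`-semigroup
`(S(t))_{t ≥ 0}`. -/
structure IsSemigroup (A : E →ₗ.[ℂ] E) (C : E →L[ℂ] E) (K : ℝ → ℂ)
    (S : ℝ → E →L[ℂ] E) : Prop where
  closed : A.IsClosed
  kernel : IsConvolutionFunction K
  strongly_continuous : StronglyContinuous S
  commutes_gen : ∀ t : ℝ, 0 ≤ t → CommutesWith (S t) A
  commutes_C : ∀ t : ℝ, 0 ≤ t → ∀ x : E, S t (C x) = C (S t x)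
  integral_eq : ∀ t : ℝ, 0 ≤ t → ∀ x : E,
    ∃ h : (∫ s in (0 : ℝ)..t, S s x) ∈ A.domain,
      A ⟨∫ s in (0 : ℝ)..t, S s x, h⟩ = S t x - Theta K t • C x

/-- The open sector `Σ_α = {r e^{iθ} : r > 0, |θ| < α}`, for `0 < α ≤ π`. -/
def sector (α : ℝ) : Set ℂ := {z | z ≠ 0 ∧ |Complex.arg z| < α}

/-- `A` is a subgenerator of the exponentially bounded, analytic `K`-convoluted `C`-semigroup
`(S(t))_{t ≥ 0}` of angle `α`: there is an analytic extension `SS : Σ_α → L(E)` of `S` which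
tends strongly to `0` at the origin and is exponentially bounded, in every smaller sector. -/
structure IsExpBoundedAnalyticSemigroup (A : E →ₗ.[ℂ] E) (C : E →L[ℂ] E) (K : ℝ → ℂ)
    (S : ℝ → E →L[ℂ] E) (α : ℝ) : Prop where
  angle_pos : 0 < α
  angle_le : α ≤ Real.pi / 2
  semigroup : IsSemigroup A C K S
  extension : ∃ SS : ℂ → E →L[ℂ] E,
    AnalyticOnNhd ℂ SS (sector α) ∧
    (∀ t : ℝ, 0 < t → SS (t : ℂ) = S t) ∧
    (∀ γ : ℝ, 0 < γ → γ < α → ∀ x : E,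
      Tendsto (fun z => SS z x) (𝓝[sector γ] (0 : ℂ)) (𝓝 (0 : E))) ∧
    (∀ γ : ℝ, 0 < γ → γ < α → ∃ M : ℝ, 0 < M ∧ ∃ ω : ℝ, 0 < ω ∧
      ∀ z ∈ sector γ, ‖SS z‖ ≤ M * Real.exp (ω * z.re))

/-- `K₁(t) = ∫₀^∞ s e^{-s²/(4t)} / (2 √π t^{3/2}) K(s) ds` (relevant for `t > 0`). -/
def weierstrassKernel (K : ℝ → ℂ) (t : ℝ) : ℂ :=
  ∫ s in Ioi (0 : ℝ),
    ((s * Real.exp (-s ^ 2 / (4 * t)) / (2 * Real.sqrt Real.pi * t ^ (3 / 2 : ℝ)) : ℝ) : ℂ) * K s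

end Convoluted

end

noncomputable section

namespace Convoluted

/-! This is the Weierstrass formula: with p(t,s) = (πt)^{-1/2} e^{-s²/4t}, put S(t) = ∫₀^∞ p(t,s)
C_K(s) ds. Everything rests on the heat equation ∂ₜp = ∂ₛ²p, used in integrated form and without
Laplace transforms. Integrated in time, p(·,r) becomes ∫_r^∞ (s-r) p(t,s) ds
(`integral_heatKernel_time`) and the flux -∂ᵣp becomes the tail mass ∫_r^∞ p(t,s) ds
(`integral_heatFlux`). By Fubini, ∫₀ᵗ S(τ)x dτ is the heat transform of ∫₀ˢ (s-r) C_K(r)x dr, and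
∫₀ᵗ K₁ is the heat transform of Θ. Since A is closed, it passes under the s-integral
(`integral_mem_graph`), so the cosine identity, averaged against p(t,·), is the semigroup identity.
K₁ is nonzero because its values are Gaussian moments of K, and by polynomial approximation in
e^{-s²} these determine K (`ae_eq_zero_of_integral_gauss_pow`). For analyticity, 1/t becomes 1/z
with Re z > 0, and the Gaussian integral is differentiated in operator norm
(`hasDerivAt_strongIntegral_gaussWeight`). In a smaller sector Re(1/z) ≥ cos γ/|z|, so rescaling by
√|z| gives both the exponential bound and, since C_K(0) = 0, the limit at the origin. -/

/-! ### Calculus of the heat kernel on the half-line. -/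

theorem integrable_exp_quadratic {a : ℝ} (ha : 0 < a) (b : ℝ) :
    Integrable (fun s : ℝ => Real.exp (-a * s ^ 2 + b * s)) := by
  have h := (integrable_cexp_quadratic (b := (a : ℂ)) (by simpa using ha) (b : ℂ) 0).norm
  refine h.congr (Eventually.of_forall fun s => ?_)
  simp only [Complex.norm_exp]
  congr 1
  simp [← Complex.ofReal_pow, ← Complex.ofReal_mul, ← Complex.ofReal_neg, ← Complex.ofReal_add]

/-- The (one-dimensional, even) heat kernel, normalised on the half-line. -/
def heatKernel (t s : ℝ) : ℝ := 1 / Real.sqrt (Real.pi * t) * Real.exp (-s ^ 2 / (4 * t))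

/-- Minus the space derivative of the heat kernel. -/
def heatFlux (t s : ℝ) : ℝ :=
  s * Real.exp (-s ^ 2 / (4 * t)) / (2 * Real.sqrt Real.pi * t ^ (3 / 2 : ℝ))

/-- The mass of the heat kernel beyond `r`. -/
def heatTail (t r : ℝ) : ℝ := ∫ s in Ioi r, heatKernel t s

theorem heatKernel_nonneg (t s : ℝ) : 0 ≤ heatKernel t s := by
  unfold heatKernel; positivity

theorem heatFlux_nonneg {t s : ℝ} (ht : 0 < t) (hs : 0 ≤ s) : 0 ≤ heatFlux t s := by
  unfold heatFlux; positivity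

@[simp] theorem heatKernel_zero (s : ℝ) : heatKernel 0 s = 0 := by simp [heatKernel]

@[simp] theorem heatTail_zero (r : ℝ) : heatTail 0 r = 0 := by simp [heatTail]

theorem continuous_heatKernel (t : ℝ) : Continuous (heatKernel t) := by
  unfold heatKernel; fun_prop

theorem integrable_heatKernel_mul_exp {t : ℝ} (ht : 0 < t) (b : ℝ) :
    Integrable (fun s => heatKernel t s * Real.exp (b * s)) := by
  refine ((integrable_exp_quadratic (a := 1 / (4 * t)) (by positivity) b).const_mul
    (1 / Real.sqrt (Real.pi * t))).congr (Eventually.of_forall fun s => ?_)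
  simp only [heatKernel, Real.exp_add, mul_assoc]
  congr 3
  ring

theorem integrable_heatKernel {t : ℝ} (ht : 0 < t) : Integrable (heatKernel t) := by
  simpa using integrable_heatKernel_mul_exp ht 0

/-- An antiderivative of the Gaussian which vanishes at infinity. -/
def gaussTail (y : ℝ) : ℝ := ∫ u in Ioi y, Real.exp (-u ^ 2)

theorem integrable_exp_neg_sq : Integrable (fun u : ℝ => Real.exp (-u ^ 2)) := by
  simpa using integrable_exp_neg_mul_sq one_pos

theorem gaussTail_eq (y : ℝ) :
    gaussTail y = gaussTail 0 - ∫ u in (0 : ℝ)..y, Real.exp (-u ^ 2) := by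
  have := intervalIntegral.integral_interval_add_Ioi (a := 0) (b := y)
    (f := fun u : ℝ => Real.exp (-u ^ 2)) integrable_exp_neg_sq.integrableOn
    integrable_exp_neg_sq.integrableOn
  simp only [gaussTail]
  linarith

theorem hasDerivAt_gaussTail (y : ℝ) : HasDerivAt gaussTail (-Real.exp (-y ^ 2)) y := by
  have hc : Continuous (fun u : ℝ => Real.exp (-u ^ 2)) := by fun_prop
  have h := (hc.integral_hasStrictDerivAt 0 y).hasDerivAt.const_sub (gaussTail 0)
  exact h.congr_of_eventuallyEq (Eventually.of_forall gaussTail_eq)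

theorem tendsto_gaussTail : Tendsto gaussTail atTop (𝓝 0) := by
  have h := (intervalIntegral_tendsto_integral_Ioi 0
    integrable_exp_neg_sq.integrableOn tendsto_id).const_sub (gaussTail 0)
  rw [show gaussTail 0 - ∫ u in Ioi (0 : ℝ), Real.exp (-u ^ 2) = 0 from sub_self _] at h
  exact h.congr fun y => (gaussTail_eq y).symm

/-- The substitution u = s/(2√t) moves t from the integrand into the endpoint, so the time
derivative and the limit at t = 0 need no differentiation under the integral. -/
theorem heatTail_eq_gaussTail {t : ℝ} (ht : 0 < t) (r : ℝ) :
    heatTail t r = 2 / Real.sqrt Real.pi * gaussTail (r / (2 * Real.sqrt t)) := by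
  have hs : 0 < Real.sqrt t := Real.sqrt_pos.2 ht
  have hp : 0 < Real.sqrt Real.pi := Real.sqrt_pos.2 Real.pi_pos
  have h := integral_comp_mul_left_Ioi (fun u : ℝ => Real.exp (-u ^ 2)) r
    (b := (2 * Real.sqrt t)⁻¹) (by positivity)
  have e : ∀ s, heatKernel t s = (1 / Real.sqrt (Real.pi * t)) *
      Real.exp (-((2 * Real.sqrt t)⁻¹ * s) ^ 2) := by
    intro s
    unfold heatKernel
    congr 2
    rw [mul_pow, inv_pow, mul_pow, Real.sq_sqrt ht.le]
    field_simp
    norm_num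
  simp only [heatTail, e]
  rw [integral_const_mul, h, gaussTail, Real.sqrt_mul Real.pi_pos.le,
    show (2 * Real.sqrt t)⁻¹ * r = r / (2 * Real.sqrt t) by ring]
  simp only [smul_eq_mul, inv_inv]
  field_simp

theorem rpow_three_halves {t : ℝ} (ht : 0 < t) : t ^ (3 / 2 : ℝ) = t * Real.sqrt t := by
  rw [Real.sqrt_eq_rpow, ← Real.rpow_one_add' ht.le (by norm_num)]
  norm_num

theorem heatFlux_eq {t : ℝ} (ht : 0 < t) (r : ℝ) :
    heatFlux t r = r / (2 * t) * heatKernel t r := by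
  rw [heatFlux, heatKernel, rpow_three_halves ht, Real.sqrt_mul Real.pi_pos.le]
  have hs : 0 < Real.sqrt t := Real.sqrt_pos.2 ht
  field_simp

theorem hasDerivAt_heatTail {t : ℝ} (ht : 0 < t) (r : ℝ) :
    HasDerivAt (fun τ => heatTail τ r) (heatFlux t r) t := by
  have hs : 0 < Real.sqrt t := Real.sqrt_pos.2 ht
  have h1 : HasDerivAt (fun τ => r / (2 * Real.sqrt τ)) (-r / (4 * (t * Real.sqrt t))) t := by
    have := ((Real.hasDerivAt_sqrt ht.ne').const_mul 2).inv (by positivity) |>.const_mul r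
    refine this.congr_deriv ?_
    rw [mul_pow, Real.sq_sqrt ht.le]
    field_simp
    norm_num
  have h2 := ((hasDerivAt_gaussTail (r / (2 * Real.sqrt t))).comp t h1).const_mul
    (2 / Real.sqrt Real.pi)
  have h3 : HasDerivAt (fun τ => heatTail τ r) _ t := h2.congr_of_eventuallyEq (by
    filter_upwards [lt_mem_nhds ht] with τ hτ using heatTail_eq_gaussTail hτ r)
  refine h3.congr_deriv ?_
  rw [heatFlux, rpow_three_halves ht, div_pow, mul_pow, Real.sq_sqrt ht.le]
  rw [show -(r ^ 2 / (2 ^ 2 * t)) = -r ^ 2 / (4 * t) by ring]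
  field_simp
  ring

theorem tendsto_div_sqrt_nhdsGT {r : ℝ} (hr : 0 < r) :
    Tendsto (fun t => r / (2 * Real.sqrt t)) (𝓝[>] 0) atTop := by
  have h : Tendsto (fun t => 2 * Real.sqrt t) (𝓝[>] 0) (𝓝[>] 0) := by
    refine tendsto_nhdsWithin_iff.2 ⟨?_, ?_⟩
    · have : Continuous (fun t => 2 * Real.sqrt t) := by fun_prop
      simpa using (this.tendsto 0).mono_left nhdsWithin_le_nhds
    · filter_upwards [self_mem_nhdsWithin] with t (ht : 0 < t)
      have := Real.sqrt_pos.2 ht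
      simpa using this
  exact (tendsto_inv_nhdsGT_zero.comp h).const_mul_atTop hr

theorem tendsto_heatTail {r : ℝ} (hr : 0 < r) :
    Tendsto (fun t => heatTail t r) (𝓝[>] 0) (𝓝 0) := by
  have h := (tendsto_gaussTail.comp (tendsto_div_sqrt_nhdsGT hr)).const_mul
    (2 / Real.sqrt Real.pi)
  rw [mul_zero] at h
  refine h.congr' ?_
  filter_upwards [self_mem_nhdsWithin] with t ht using (heatTail_eq_gaussTail ht r).symm

/-- A nonnegative derivative of a continuous function is automatically integrable, so the
singularity at time 0 needs no estimate. -/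
theorem integral_eq_of_hasDerivAt_of_pos {F F' : ℝ → ℝ} {t : ℝ} (ht : 0 < t) (h0 : F 0 = 0)
    (hlim : Tendsto F (𝓝[>] 0) (𝓝 0)) (hF : ∀ τ, 0 < τ → HasDerivAt F (F' τ) τ)
    (hpos : ∀ τ, 0 < τ → 0 ≤ F' τ) :
    ∫ τ in (0 : ℝ)..t, F' τ = F t := by
  have hc : ContinuousOn F (Icc 0 t) := by
    intro τ hτ
    rcases hτ.1.eq_or_lt with rfl | h
    · refine ContinuousWithinAt.mono (t := Ici 0) ?_ Icc_subset_Ici_self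
      rw [← continuousWithinAt_Ioi_iff_Ici, ContinuousWithinAt, h0]
      exact hlim
    · exact (hF τ h).continuousAt.continuousWithinAt
  have hi := intervalIntegral.integrableOn_deriv_of_nonneg hc (fun x hx => hF x hx.1)
    (fun x hx => hpos x hx.1)
  rw [intervalIntegral.integral_eq_sub_of_hasDerivAt_of_le ht.le hc (fun x hx => hF x hx.1)
    ((intervalIntegrable_iff_integrableOn_Ioc_of_le ht.le).2 hi), h0, sub_zero]

theorem integral_heatFlux {t r : ℝ} (ht : 0 < t) (hr : 0 < r) :
    ∫ τ in (0 : ℝ)..t, heatFlux τ r = heatTail t r :=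
  integral_eq_of_hasDerivAt_of_pos (F := fun τ => heatTail τ r) ht (heatTail_zero r)
    (tendsto_heatTail hr) (fun _ h => hasDerivAt_heatTail h r)
    (fun _ h => heatFlux_nonneg h hr.le)

theorem hasDerivAt_heatKernel_space {t : ℝ} (ht : 0 < t) (s : ℝ) :
    HasDerivAt (fun s => -(2 * t) * heatKernel t s) (s * heatKernel t s) s := by
  have h1 : HasDerivAt (fun s : ℝ => -s ^ 2 / (4 * t)) (-(2 * s) / (4 * t)) s := by
    simpa using ((hasDerivAt_pow 2 s).neg.div_const (4 * t))
  have h2 := (h1.exp.const_mul (1 / Real.sqrt (Real.pi * t))).const_mul (-(2 * t))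
  refine h2.congr_deriv ?_
  unfold heatKernel
  have := ht.ne'
  field_simp
  ring

theorem hasDerivAt_heatKernel_time {t : ℝ} (ht : 0 < t) (r : ℝ) :
    HasDerivAt (fun τ => heatKernel τ r)
      ((r ^ 2 / (4 * t ^ 2) - 1 / (2 * t)) * heatKernel t r) t := by
  have hs : 0 < Real.sqrt t := Real.sqrt_pos.2 ht
  have hp : 0 < Real.sqrt Real.pi := Real.sqrt_pos.2 Real.pi_pos
  have h1 : HasDerivAt (fun τ : ℝ => -r ^ 2 / (4 * τ)) (r ^ 2 / (4 * t ^ 2)) t := by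
    have := (((hasDerivAt_id t).const_mul 4).inv (by simp [ht.ne'])).const_mul (-r ^ 2)
    refine this.congr_deriv ?_
    simp only [id]
    field_simp
  have h2 : HasDerivAt (fun τ : ℝ => 1 / Real.sqrt (Real.pi * τ))
      (-(1 / (2 * t)) * (1 / Real.sqrt (Real.pi * t))) t := by
    have h3 : HasDerivAt (fun τ : ℝ => Real.pi * τ) Real.pi t := by
      simpa using (hasDerivAt_id t).const_mul Real.pi
    have := (h3.sqrt (by positivity)).inv (Real.sqrt_pos.2 (by positivity)).ne'
    simp only [one_div]
    refine this.congr_deriv ?_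
    rw [Real.sq_sqrt (by positivity)]
    field_simp
  refine (h2.mul h1.exp).congr_deriv ?_
  unfold heatKernel
  ring

theorem tendsto_mul_heatKernel (r : ℝ) :
    Tendsto (fun t => 2 * t * heatKernel t r) (𝓝[>] 0) (𝓝 0) := by
  have hp : 0 < Real.sqrt Real.pi := Real.sqrt_pos.2 Real.pi_pos
  have hb : Tendsto (fun t => 2 / Real.sqrt Real.pi * Real.sqrt t) (𝓝[>] 0) (𝓝 0) := by
    have : Continuous (fun t => 2 / Real.sqrt Real.pi * Real.sqrt t) := by fun_prop
    simpa using (this.tendsto 0).mono_left nhdsWithin_le_nhds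
  refine squeeze_zero' ?_ ?_ hb
  · filter_upwards [self_mem_nhdsWithin] with t (ht : 0 < t)
    exact mul_nonneg (by positivity) (heatKernel_nonneg _ _)
  · filter_upwards [self_mem_nhdsWithin] with t (ht : 0 < t)
    have hs : 0 < Real.sqrt t := Real.sqrt_pos.2 ht
    have he : Real.exp (-r ^ 2 / (4 * t)) ≤ 1 := by
      rw [Real.exp_le_one_iff]
      exact div_nonpos_of_nonpos_of_nonneg (by nlinarith [sq_nonneg r]) (by positivity)
    calc 2 * t * heatKernel t r ≤ 2 * t * (1 / Real.sqrt (Real.pi * t) * 1) := by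
          unfold heatKernel; gcongr
      _ = 2 / Real.sqrt Real.pi * Real.sqrt t := by
          rw [Real.sqrt_mul Real.pi_pos.le]
          field_simp
          rw [Real.sq_sqrt ht.le]

theorem tendsto_heatKernel_atTop {t : ℝ} (ht : 0 < t) :
    Tendsto (fun s => -(2 * t) * heatKernel t s) atTop (𝓝 0) := by
  have h1 : Tendsto (fun s : ℝ => -s ^ 2 / (4 * t)) atTop atBot := by
    have : Tendsto (fun s : ℝ => s ^ 2) atTop atTop := tendsto_pow_atTop (by norm_num)
    exact (tendsto_neg_atTop_atBot.comp this).atBot_div_const (by positivity)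
  have h2 := ((Real.tendsto_exp_atBot.comp h1).const_mul
    (1 / Real.sqrt (Real.pi * t))).const_mul (-(2 * t))
  simpa [heatKernel, Function.comp_def] using h2

/-- Since s·p = -2t ∂ₛp, the first moment is explicit; the resulting closed form is easy to
differentiate in t. -/
theorem integral_sub_mul_heatKernel {t r : ℝ} (ht : 0 < t) (hr : 0 ≤ r) :
    ∫ s in Ioi r, heatKernel t s * (s - r) = 2 * t * heatKernel t r - r * heatTail t r := by
  have hd : ∀ x ∈ Ici r, HasDerivAt (fun s => -(2 * t) * heatKernel t s)
      (x * heatKernel t x) x := fun x _ => hasDerivAt_heatKernel_space ht x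
  have hn : ∀ x ∈ Ioi r, 0 ≤ x * heatKernel t x := fun x hx =>
    mul_nonneg (hr.trans (le_of_lt hx)) (heatKernel_nonneg _ _)
  have hi := integrableOn_Ioi_deriv_of_nonneg' hd hn (tendsto_heatKernel_atTop ht)
  have h := integral_Ioi_of_hasDerivAt_of_nonneg' hd hn (tendsto_heatKernel_atTop ht)
  have e : ∀ s, heatKernel t s * (s - r) = s * heatKernel t s - r * heatKernel t s := by
    intro s; ring
  simp only [e]
  rw [integral_sub hi ((integrable_heatKernel ht).integrableOn.const_mul r), h,
    integral_const_mul, heatTail]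
  ring

theorem integral_heatKernel_time {t r : ℝ} (ht : 0 < t) (hr : 0 < r) :
    ∫ τ in (0 : ℝ)..t, heatKernel τ r = ∫ s in Ioi r, heatKernel t s * (s - r) := by
  rw [integral_sub_mul_heatKernel ht hr.le]
  refine integral_eq_of_hasDerivAt_of_pos
    (F := fun τ => 2 * τ * heatKernel τ r - r * heatTail τ r) ht (by simp) ?_ ?_
    (fun _ _ => heatKernel_nonneg _ _)
  · simpa using (tendsto_mul_heatKernel r).sub ((tendsto_heatTail hr).const_mul r)
  · intro τ hτ
    -- The r² terms from the kernel and from the flux cancel, leaving 2p - p = p.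
    have h1 := (((hasDerivAt_id τ).const_mul 2).mul (hasDerivAt_heatKernel_time hτ r)).sub
      ((hasDerivAt_heatTail hτ r).const_mul r)
    refine h1.congr_deriv ?_
    rw [heatFlux_eq hτ]
    simp only [id]
    field_simp
    ring

/-! ### Fubini for heat transforms of exponentially bounded functions. -/

section Fubini

variable {F : Type*} [NormedAddCommGroup F] [NormedSpace ℝ F]

theorem integrableOn_smul_of_exp_bound {M b : ℝ} {g : ℝ → F}
    (hg : AEStronglyMeasurable g (volume.restrict (Ioi 0)))
    (hb : ∀ᵐ r ∂(volume.restrict (Ioi (0 : ℝ))), ‖g r‖ ≤ M * Real.exp (b * r))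
    {φ : ℝ → ℝ} (hφ : AEStronglyMeasurable φ (volume.restrict (Ioi 0)))
    (hi : IntegrableOn (fun r => φ r * Real.exp (b * r)) (Ioi 0)) :
    IntegrableOn (fun r => φ r • g r) (Ioi 0) := by
  refine Integrable.mono' (hi.norm.mul_const M) (hφ.smul hg) ?_
  filter_upwards [hb] with r hr
  rw [norm_smul, norm_mul, Real.norm_eq_abs (Real.exp _), Real.abs_exp, mul_assoc]
  gcongr
  linarith

/-- A majorant that factors as u(τ)v(r) reduces integrability on the product to one variable at a
time. -/
theorem integrable_prod_of_exp_bound {M b : ℝ} {g : ℝ → F}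
    (hg : AEStronglyMeasurable g (volume.restrict (Ioi 0)))
    (hb : ∀ᵐ r ∂(volume.restrict (Ioi (0 : ℝ))), ‖g r‖ ≤ M * Real.exp (b * r))
    {I : Set ℝ} (hI : MeasurableSet I) {h : ℝ → ℝ → ℝ} (hh : Measurable (Function.uncurry h))
    {u v : ℝ → ℝ} (hu : IntegrableOn u I) (hv : IntegrableOn v (Ioi 0))
    (huv : ∀ τ ∈ I, ∀ r ∈ Ioi (0 : ℝ), |h τ r| * (M * Real.exp (b * r)) ≤ u τ * v r) :
    Integrable (Function.uncurry fun τ r => h τ r • g r)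
      ((volume.restrict I).prod (volume.restrict (Ioi 0))) := by
  have h1 : ∀ᵐ q ∂((volume.restrict I).prod (volume.restrict (Ioi (0 : ℝ)))), q.1 ∈ I :=
    Measure.quasiMeasurePreserving_fst.ae (ae_restrict_mem hI)
  have h2 : ∀ᵐ q ∂((volume.restrict I).prod (volume.restrict (Ioi (0 : ℝ)))),
      q.2 ∈ Ioi (0 : ℝ) :=
    Measure.quasiMeasurePreserving_snd.ae (ae_restrict_mem measurableSet_Ioi)
  have h3 : ∀ᵐ q ∂((volume.restrict I).prod (volume.restrict (Ioi (0 : ℝ)))),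
      ‖g q.2‖ ≤ M * Real.exp (b * q.2) := Measure.quasiMeasurePreserving_snd.ae hb
  refine Integrable.mono' (hu.mul_prod hv) (hh.aestronglyMeasurable.smul hg.comp_snd) ?_
  filter_upwards [h1, h2, h3] with q hq1 hq2 hq3
  refine le_trans ?_ (huv q.1 hq1 q.2 hq2)
  simp only [Function.uncurry, norm_smul, Real.norm_eq_abs]
  gcongr

/-- Treats both primitives at once: p = 1 gives the first, p(v) = v the second. -/
theorem integral_heatKernel_smul_convolution {M b : ℝ} (hM : 0 ≤ M) (hb0 : 0 ≤ b) {g : ℝ → F}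
    [CompleteSpace F]
    (hg : AEStronglyMeasurable g (volume.restrict (Ioi 0)))
    (hb : ∀ᵐ r ∂(volume.restrict (Ioi (0 : ℝ))), ‖g r‖ ≤ M * Real.exp (b * r))
    {p : ℝ → ℝ} (hp : Continuous p) (hpb : ∀ v, 0 ≤ v → |p v| ≤ Real.exp v) {t : ℝ}
    (ht : 0 < t) :
    IntegrableOn (fun s => heatKernel t s • ∫ r in (0 : ℝ)..s, p (s - r) • g r) (Ioi 0) ∧
    ∫ s in Ioi 0, heatKernel t s • ∫ r in (0 : ℝ)..s, p (s - r) • g r =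
      ∫ r in Ioi 0, (∫ s in Ioi r, heatKernel t s * p (s - r)) • g r := by
  let h : ℝ → ℝ → ℝ := fun s r => (Ioi r).indicator (fun s => heatKernel t s * p (s - r)) s
  have hh : Measurable (Function.uncurry h) := by
    have : Function.uncurry h = {q : ℝ × ℝ | q.2 < q.1}.indicator
        (fun q => heatKernel t q.1 * p (q.1 - q.2)) := by
      ext q
      simp [h, Function.uncurry, indicator]
    rw [this]
    refine Measurable.indicator ?_ (measurableSet_lt measurable_snd measurable_fst)
    have := continuous_heatKernel t
    exact Continuous.measurable (by fun_prop)
  -- For r < s, |p(s-r)| ≤ e^{s-r} and e^{br} ≤ e^{bs} (as b ≥ 0); the factor e^{-r} supplies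
  -- integrability in r, and the Gaussian absorbs e^{(b+1)s}.
  have hint := integrable_prod_of_exp_bound hg hb (I := Ioi 0) measurableSet_Ioi (h := h) hh
    (u := fun s => heatKernel t s * Real.exp ((b + 1) * s)) (v := fun r => M * Real.exp (-r))
    (integrable_heatKernel_mul_exp ht _).integrableOn
    ((integrableOn_exp_neg_Ioi 0).const_mul M) (by
      intro s hs r hr
      by_cases hrs : r < s
      · simp only [h, indicator, mem_Ioi, hrs, if_true, abs_mul,
          abs_of_nonneg (heatKernel_nonneg t s)]
        calc heatKernel t s * |p (s - r)| * (M * Real.exp (b * r))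
            ≤ heatKernel t s * Real.exp (s - r) * (M * Real.exp (b * s)) := by
              have := heatKernel_nonneg t s
              gcongr
              exact hpb _ (by linarith)
          _ = _ := by
              rw [add_mul, Real.exp_add, one_mul, sub_eq_add_neg, Real.exp_add]
              ring
      · simp only [h, indicator, mem_Ioi, hrs, if_false, abs_zero, zero_mul]
        have := heatKernel_nonneg t s
        positivity)
  have hswap := integral_integral_swap hint
  have e1 : ∀ s ∈ Ioi (0 : ℝ), ∫ r in Ioi 0, h s r • g r =
      heatKernel t s • ∫ r in (0 : ℝ)..s, p (s - r) • g r := by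
    intro s hs
    have : ∀ r, h s r • g r = (Iio s).indicator
        (fun r => heatKernel t s • p (s - r) • g r) r := by
      intro r
      simp only [h, indicator, mem_Ioi, mem_Iio]
      split_ifs <;> simp [mul_smul]
    simp only [this]
    rw [setIntegral_indicator measurableSet_Iio, Ioi_inter_Iio, integral_smul,
      intervalIntegral.integral_of_le (le_of_lt hs), integral_Ioc_eq_integral_Ioo]
  have e2 : ∀ r ∈ Ioi (0 : ℝ), ∫ s in Ioi 0, h s r • g r =
      (∫ s in Ioi r, heatKernel t s * p (s - r)) • g r := by
    intro r hr
    rw [integral_smul_const]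
    simp only [h]
    rw [setIntegral_indicator measurableSet_Ioi, Ioi_inter_Ioi, sup_eq_right.2 (le_of_lt hr)]
  rw [setIntegral_congr_fun measurableSet_Ioi e1, setIntegral_congr_fun measurableSet_Ioi e2]
    at hswap
  exact ⟨(integrableOn_congr_fun e1 measurableSet_Ioi).1 hint.integral_prod_left, hswap⟩

theorem integral_integral_time_swap [CompleteSpace F] {g : ℝ → F} {h : ℝ → ℝ → ℝ} {t : ℝ}
    (ht : 0 < t)
    (hint : Integrable (Function.uncurry fun τ r => h τ r • g r)
      ((volume.restrict (Ioc 0 t)).prod (volume.restrict (Ioi 0)))) :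
    ∫ τ in (0 : ℝ)..t, ∫ r in Ioi 0, h τ r • g r =
      ∫ r in Ioi 0, (∫ τ in (0 : ℝ)..t, h τ r) • g r := by
  simp only [intervalIntegral.integral_of_le ht.le]
  rw [integral_integral_swap hint]
  simp only [integral_smul_const]

theorem measurable_heatKernel : Measurable (Function.uncurry heatKernel) := by
  unfold heatKernel Function.uncurry; fun_prop

theorem measurable_heatFlux : Measurable (Function.uncurry heatFlux) := by
  unfold heatFlux Function.uncurry; fun_prop

theorem heatKernel_le_of_le {τ t : ℝ} (hτ : 0 < τ) (hτt : τ ≤ t) (r : ℝ) :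
    heatKernel τ r ≤ τ ^ (-(1 / 2) : ℝ) * Real.exp (-(1 / (4 * t)) * r ^ 2) := by
  unfold heatKernel
  have ht := hτ.trans_le hτt
  gcongr
  · rw [Real.rpow_neg hτ.le, ← Real.sqrt_eq_rpow, one_div]
    have : 0 < Real.sqrt τ := Real.sqrt_pos.2 hτ
    gcongr
    nlinarith [Real.pi_gt_three]
  · rw [neg_mul, neg_div, neg_le_neg_iff, one_div_mul_eq_div]
    gcongr

theorem rpow_mul_exp_neg_le_one {x : ℝ} (hx : 0 ≤ x) : x ^ (3 / 4 : ℝ) * Real.exp (-x) ≤ 1 := by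
  have h1 : x ^ (3 / 4 : ℝ) ≤ Real.exp x := calc
    x ^ (3 / 4 : ℝ) ≤ (x + 1) ^ (3 / 4 : ℝ) := by gcongr; linarith
    _ ≤ (x + 1) ^ (1 : ℝ) := Real.rpow_le_rpow_of_exponent_le (by linarith) (by norm_num)
    _ ≤ Real.exp x := by rw [Real.rpow_one]; exact Real.add_one_le_exp x
  rw [Real.exp_neg, ← div_eq_mul_inv, div_le_one (Real.exp_pos x)]
  exact h1

/-- The factor τ^{-3/2} is not integrable at 0. Half of the Gaussian, through x^{3/4}e^{-x} ≤ 1 at x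
= r²/(8τ), trades r τ^{-3/2} for τ^{-3/4} r^{-1/2}, integrable at 0 in each variable; the other half
keeps the decay in r. -/
theorem heatFlux_le_of_le {τ t : ℝ} (hτ : 0 < τ) (hτt : τ ≤ t) {r : ℝ} (hr : 0 < r) :
    heatFlux τ r ≤ τ ^ (-(3 / 4) : ℝ) *
      (8 ^ (3 / 4 : ℝ) * (r ^ (-(1 / 2) : ℝ) * Real.exp (-(1 / (8 * t)) * r ^ 2))) := by
  have ht := hτ.trans_le hτt
  have hx : 0 ≤ r ^ 2 / (8 * τ) := by positivity
  have key := rpow_mul_exp_neg_le_one hx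
  have e1 : r / τ ^ (3 / 2 : ℝ) = τ ^ (-(3 / 4) : ℝ) * (8 ^ (3 / 4 : ℝ) * r ^ (-(1 / 2) : ℝ)) *
      (r ^ 2 / (8 * τ)) ^ (3 / 4 : ℝ) := by
    rw [Real.div_rpow (by positivity) (by positivity), Real.mul_rpow (by norm_num) hτ.le,
      ← Real.rpow_natCast r 2, ← Real.rpow_mul hr.le]
    have a1 : r ^ ((2 : ℕ) * (3 / 4) : ℝ) = r * r ^ (1 / 2 : ℝ) := by
      rw [← Real.rpow_one_add' hr.le (by norm_num)]; norm_num
    have a2 : τ ^ (3 / 2 : ℝ) = τ ^ (3 / 4 : ℝ) * τ ^ (3 / 4 : ℝ) := by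
      rw [← Real.rpow_add hτ]; norm_num
    rw [a1, a2, Real.rpow_neg hτ.le, Real.rpow_neg hr.le]
    have : 0 < τ ^ (3 / 4 : ℝ) := by positivity
    have : 0 < r ^ (1 / 2 : ℝ) := by positivity
    field_simp
  have e2 : Real.exp (-r ^ 2 / (4 * τ)) =
      Real.exp (-(r ^ 2 / (8 * τ))) * Real.exp (-(r ^ 2 / (8 * τ))) := by
    rw [← Real.exp_add]; congr 1; field_simp; norm_num
  have hpi : 1 ≤ 2 * Real.sqrt Real.pi := by
    have : 1 ≤ Real.sqrt Real.pi := Real.one_le_sqrt.2 (by linarith [Real.pi_gt_three])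
    linarith
  have e3 : Real.exp (-(r ^ 2 / (8 * τ))) ≤ Real.exp (-(1 / (8 * t)) * r ^ 2) := by
    gcongr
    rw [neg_mul, neg_le_neg_iff, one_div_mul_eq_div]
    gcongr
  calc heatFlux τ r
      = 1 / (2 * Real.sqrt Real.pi) * (r / τ ^ (3 / 2 : ℝ)) * Real.exp (-r ^ 2 / (4 * τ)) := by
        unfold heatFlux; field_simp
    _ ≤ 1 * (r / τ ^ (3 / 2 : ℝ)) * Real.exp (-r ^ 2 / (4 * τ)) := by
        gcongr
        rw [div_le_one (by positivity)]
        exact hpi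
    _ = τ ^ (-(3 / 4) : ℝ) * (8 ^ (3 / 4 : ℝ) * r ^ (-(1 / 2) : ℝ)) *
        ((r ^ 2 / (8 * τ)) ^ (3 / 4 : ℝ) * Real.exp (-(r ^ 2 / (8 * τ)))) *
        Real.exp (-(r ^ 2 / (8 * τ))) := by rw [e1, e2]; ring
    _ ≤ τ ^ (-(3 / 4) : ℝ) * (8 ^ (3 / 4 : ℝ) * r ^ (-(1 / 2) : ℝ)) * 1 *
        Real.exp (-(1 / (8 * t)) * r ^ 2) := by gcongr
    _ = _ := by ring

theorem integrable_heatKernel_time_prod {M b : ℝ} (hM : 0 ≤ M) {g : ℝ → F}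
    (hg : AEStronglyMeasurable g (volume.restrict (Ioi 0)))
    (hb : ∀ᵐ r ∂(volume.restrict (Ioi (0 : ℝ))), ‖g r‖ ≤ M * Real.exp (b * r)) {t : ℝ}
    (ht : 0 < t) :
    Integrable (Function.uncurry fun τ r => heatKernel τ r • g r)
      ((volume.restrict (Ioc 0 t)).prod (volume.restrict (Ioi 0))) := by
  refine integrable_prod_of_exp_bound hg hb measurableSet_Ioc measurable_heatKernel
    (u := fun τ => τ ^ (-(1 / 2) : ℝ))
    (v := fun r => M * Real.exp (-(1 / (4 * t)) * r ^ 2 + b * r)) ?_ ?_ ?_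
  · exact (intervalIntegrable_iff_integrableOn_Ioc_of_le ht.le).1
      (intervalIntegral.intervalIntegrable_rpow' (by norm_num))
  · exact ((integrable_exp_quadratic (by positivity) b).const_mul M).integrableOn
  · intro τ hτ r _
    rw [abs_of_nonneg (heatKernel_nonneg τ r), Real.exp_add]
    calc heatKernel τ r * (M * Real.exp (b * r)) ≤
        (τ ^ (-(1 / 2) : ℝ) * Real.exp (-(1 / (4 * t)) * r ^ 2)) * (M * Real.exp (b * r)) := by
          gcongr
          exact heatKernel_le_of_le hτ.1 hτ.2 r
      _ = _ := by ring

theorem integrable_heatFlux_time_prod {M b : ℝ} (hM : 0 ≤ M) {g : ℝ → F}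
    (hg : AEStronglyMeasurable g (volume.restrict (Ioi 0)))
    (hb : ∀ᵐ r ∂(volume.restrict (Ioi (0 : ℝ))), ‖g r‖ ≤ M * Real.exp (b * r)) {t : ℝ}
    (ht : 0 < t) :
    Integrable (Function.uncurry fun τ r => heatFlux τ r • g r)
      ((volume.restrict (Ioc 0 t)).prod (volume.restrict (Ioi 0))) := by
  refine integrable_prod_of_exp_bound hg hb measurableSet_Ioc measurable_heatFlux
    (u := fun τ => τ ^ (-(3 / 4) : ℝ))
    (v := fun r => 8 ^ (3 / 4 : ℝ) * M * Real.exp (4 * b ^ 2 * t) *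
      (r ^ (-(1 / 2) : ℝ) * Real.exp (-(1 / (16 * t)) * r ^ 2))) ?_ ?_ ?_
  · exact (intervalIntegrable_iff_integrableOn_Ioc_of_le ht.le).1
      (intervalIntegral.intervalIntegrable_rpow' (by norm_num))
  · exact ((integrable_rpow_mul_exp_neg_mul_sq (by positivity) (by norm_num)).const_mul
      _).integrableOn
  · intro τ hτ r hr
    have hr' : 0 < r := hr
    have hτ' : 0 < τ := hτ.1
    rw [abs_of_nonneg (heatFlux_nonneg hτ.1 (le_of_lt hr))]
    -- Completing the square: br - r²/(16t) is maximal at r = 8bt, with value 4b²t.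
    have e : Real.exp (-(1 / (8 * t)) * r ^ 2) * Real.exp (b * r) ≤
        Real.exp (4 * b ^ 2 * t) * Real.exp (-(1 / (16 * t)) * r ^ 2) := by
      rw [← Real.exp_add, ← Real.exp_add, Real.exp_le_exp]
      have h : 0 ≤ (r - 8 * b * t) ^ 2 / (16 * t) := by positivity
      have : (r - 8 * b * t) ^ 2 / (16 * t) =
        4 * b ^ 2 * t + -(1 / (16 * t)) * r ^ 2 - (-(1 / (8 * t)) * r ^ 2 + b * r) := by
        field_simp
        ring
      linarith
    calc heatFlux τ r * (M * Real.exp (b * r)) ≤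
        (τ ^ (-(3 / 4) : ℝ) * (8 ^ (3 / 4 : ℝ) * (r ^ (-(1 / 2) : ℝ) *
          Real.exp (-(1 / (8 * t)) * r ^ 2)))) * (M * Real.exp (b * r)) := by
          gcongr
          exact heatFlux_le_of_le hτ.1 hτ.2 hr
      _ = τ ^ (-(3 / 4) : ℝ) * (8 ^ (3 / 4 : ℝ) * M * r ^ (-(1 / 2) : ℝ)) *
          (Real.exp (-(1 / (8 * t)) * r ^ 2) * Real.exp (b * r)) := by ring
      _ ≤ τ ^ (-(3 / 4) : ℝ) * (8 ^ (3 / 4 : ℝ) * M * r ^ (-(1 / 2) : ℝ)) *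
          (Real.exp (4 * b ^ 2 * t) * Real.exp (-(1 / (16 * t)) * r ^ 2)) := by gcongr
      _ = _ := by ring

/-- The heat flux of `g` integrates in time to the heat transform of the primitive of `g`. -/
theorem integral_integral_heatFlux [CompleteSpace F] {M b : ℝ} (hM : 0 ≤ M) (hb0 : 0 ≤ b)
    {g : ℝ → F} (hg : AEStronglyMeasurable g (volume.restrict (Ioi 0)))
    (hb : ∀ᵐ r ∂(volume.restrict (Ioi (0 : ℝ))), ‖g r‖ ≤ M * Real.exp (b * r)) {t : ℝ}
    (ht : 0 < t) :
    IntegrableOn (fun s => heatKernel t s • ∫ r in (0 : ℝ)..s, g r) (Ioi 0) ∧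
    ∫ τ in (0 : ℝ)..t, ∫ r in Ioi 0, heatFlux τ r • g r =
      ∫ s in Ioi 0, heatKernel t s • ∫ r in (0 : ℝ)..s, g r := by
  rw [integral_integral_time_swap ht (integrable_heatFlux_time_prod hM hg hb ht)]
  have h := integral_heatKernel_smul_convolution hM hb0 hg hb (p := fun _ => 1)
    continuous_const (fun v hv => by simpa using hv) ht
  simp only [one_smul, mul_one] at h
  refine ⟨h.1, ?_⟩
  rw [h.2]
  refine setIntegral_congr_fun measurableSet_Ioi fun r hr => ?_
  simp only [integral_heatFlux ht hr, heatTail]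

/-- The heat transform of `g` integrates in time to the heat transform of the second primitive
of `g`. -/
theorem integral_integral_heatKernel [CompleteSpace F] {M b : ℝ} (hM : 0 ≤ M) (hb0 : 0 ≤ b)
    {g : ℝ → F} (hg : AEStronglyMeasurable g (volume.restrict (Ioi 0)))
    (hb : ∀ᵐ r ∂(volume.restrict (Ioi (0 : ℝ))), ‖g r‖ ≤ M * Real.exp (b * r)) {t : ℝ}
    (ht : 0 < t) :
    IntegrableOn (fun s => heatKernel t s • ∫ r in (0 : ℝ)..s, (s - r) • g r) (Ioi 0) ∧
    ∫ τ in (0 : ℝ)..t, ∫ r in Ioi 0, heatKernel τ r • g r =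
      ∫ s in Ioi 0, heatKernel t s • ∫ r in (0 : ℝ)..s, (s - r) • g r := by
  rw [integral_integral_time_swap ht (integrable_heatKernel_time_prod hM hg hb ht)]
  have h := integral_heatKernel_smul_convolution hM hb0 hg hb (p := fun v => v)
    continuous_id (fun v hv => by
      rw [abs_of_nonneg hv]; linarith [Real.add_one_le_exp v]) ht
  refine ⟨h.1, ?_⟩
  rw [h.2]
  refine setIntegral_congr_fun measurableSet_Ioi fun r hr => ?_
  simp only [integral_heatKernel_time ht hr]

end Fubini

/-! ### Uniqueness from Gaussian moments. -/

section Uniqueness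

theorem integrable_continuous_gauss_smul {G : ℝ → ℂ} (hG : IntegrableOn G (Ioi 0)) {φ : ℝ → ℝ}
    (hφ : Continuous φ) : IntegrableOn (fun s => φ (Real.exp (-s ^ 2)) • G s) (Ioi 0) := by
  obtain ⟨B, hB⟩ := (isCompact_Icc (a := (0 : ℝ)) (b := 1)).exists_bound_of_continuousOn
    hφ.continuousOn
  refine Integrable.bdd_smul hG B (φ := fun s => φ (Real.exp (-s ^ 2)))
    (Continuous.aestronglyMeasurable (by fun_prop)) (Eventually.of_forall fun s => hB _ ⟨(Real.exp_pos _).le, ?_⟩)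
  rw [Real.exp_le_one_iff]
  nlinarith [sq_nonneg s]

/-- The values of e^{-s²} lie in [0,1], where φ is a uniform limit of polynomials; integrability of
G carries the vanishing to the limit. -/
theorem integral_continuous_gauss_smul_eq_zero {G : ℝ → ℂ} (hG : IntegrableOn G (Ioi 0))
    (h : ∀ n : ℕ, ∫ s in Ioi 0, Real.exp (-s ^ 2) ^ n • G s = 0) {φ : ℝ → ℝ}
    (hφ : Continuous φ) : ∫ s in Ioi 0, φ (Real.exp (-s ^ 2)) • G s = 0 := by
  have hpoly : ∀ p : Polynomial ℝ, ∫ s in Ioi 0, p.eval (Real.exp (-s ^ 2)) • G s = 0 := by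
    intro p
    induction p using Polynomial.induction_on' with
    | add p q hp hq =>
      simp only [Polynomial.eval_add, add_smul]
      rw [integral_add (integrable_continuous_gauss_smul hG p.continuous)
        (integrable_continuous_gauss_smul hG q.continuous), hp, hq, add_zero]
    | monomial n a =>
      simp only [Polynomial.eval_monomial, mul_smul]
      rw [integral_smul, h, smul_zero]
  have hbound : ∀ ε : ℝ, 0 < ε →
      ‖∫ s in Ioi 0, φ (Real.exp (-s ^ 2)) • G s‖ ≤ ε * ∫ s in Ioi 0, ‖G s‖ := by
    intro ε hε
    obtain ⟨p, hp⟩ := exists_polynomial_near_of_continuousOn 0 1 φ hφ.continuousOn ε hε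
    rw [← sub_zero (∫ s in Ioi 0, φ (Real.exp (-s ^ 2)) • G s), ← hpoly p,
      ← integral_sub (integrable_continuous_gauss_smul hG hφ)
        (integrable_continuous_gauss_smul hG p.continuous), ← integral_const_mul]
    refine norm_integral_le_of_norm_le (hG.norm.const_mul ε) (Eventually.of_forall fun s => ?_)
    rw [← sub_smul, norm_smul, norm_sub_rev]
    gcongr
    refine (hp _ ⟨(Real.exp_pos _).le, ?_⟩).le
    rw [Real.exp_le_one_iff]
    nlinarith [sq_nonneg s]
  have hlim : Tendsto (fun ε : ℝ => ε * ∫ s in Ioi 0, ‖G s‖) (𝓝[>] 0) (𝓝 0) := by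
    have : Continuous (fun ε : ℝ => ε * ∫ s in Ioi 0, ‖G s‖) := by fun_prop
    simpa using (this.tendsto 0).mono_left nhdsWithin_le_nhds
  have := ge_of_tendsto hlim (by
    filter_upwards [self_mem_nhdsWithin] with ε hε using hbound ε hε)
  simpa using this

/-- The map y ↦ √(-log y) inverts s ↦ e^{-s²} on s > 0, so this writes a test function as a
continuous function of e^{-s²}. Continuity at y = 0 comes from the bounded support. -/
theorem continuous_comp_sqrt_neg_log {g : ℝ → ℝ} (hg : Continuous g) (hc : HasCompactSupport g)
    (hs : tsupport g ⊆ Ioi 0) : Continuous fun y => g (Real.sqrt (-Real.log y)) := by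
  rw [continuous_iff_continuousAt]
  intro y
  by_cases hy : y = 0
  · subst hy
    -- As `Real.log 0 = 0`, the value at y = 0 is g 0, which must match the limit 0.
    have h0 : g 0 = 0 := image_eq_zero_of_notMem_tsupport fun h => lt_irrefl (0 : ℝ) (hs h)
    have hinf : Tendsto (fun y => Real.sqrt (-Real.log y)) (𝓝[≠] 0) atTop :=
      Real.tendsto_sqrt_atTop.comp (tendsto_neg_atBot_atTop.comp Real.tendsto_log_nhdsNE_zero)
    have hz : ∀ᶠ x in atTop, g x = 0 := by
      obtain ⟨R, hR⟩ := hc.isCompact.bddAbove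
      filter_upwards [eventually_gt_atTop R] with x hx
      exact image_eq_zero_of_notMem_tsupport fun h => not_lt.2 (hR h) hx
    rw [continuousAt_iff_punctured_nhds]
    refine (tendsto_congr' (f₂ := fun _ => (0 : ℝ)) ?_).2 (by simp [h0])
    filter_upwards [hinf.eventually hz] with y hy using hy
  · exact hg.continuousAt.comp
      (Real.continuous_sqrt.continuousAt.comp (Real.continuousAt_log hy).neg)

/-- An integrable function on the half-line is determined by its integrals against the powers of
`exp (-s ^ 2)`. -/
theorem ae_eq_zero_of_integral_gauss_pow {G : ℝ → ℂ} (hG : IntegrableOn G (Ioi 0))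
    (h : ∀ n : ℕ, ∫ s in Ioi 0, Real.exp (-s ^ 2) ^ n • G s = 0) :
    ∀ᵐ s ∂(volume.restrict (Ioi (0 : ℝ))), G s = 0 := by
  rw [ae_restrict_iff' measurableSet_Ioi]
  refine isOpen_Ioi.ae_eq_zero_of_integral_contDiff_smul_eq_zero hG.locallyIntegrableOn ?_
  intro g hg hc hs
  rw [← integral_continuous_gauss_smul_eq_zero hG h
    (continuous_comp_sqrt_neg_log hg.continuous hc hs),
    ← setIntegral_eq_integral_of_forall_compl_eq_zero (s := Ioi 0)]
  · refine setIntegral_congr_fun measurableSet_Ioi fun s hs => ?_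
    simp only [Real.log_exp, neg_neg, Real.sqrt_sq (le_of_lt hs)]
  · intro s hs'
    rw [image_eq_zero_of_notMem_tsupport fun h => hs' (hs h), zero_smul]

end Uniqueness

/-! ### The transformed kernel K₁. -/

section Kernel

variable {K : ℝ → ℂ} {M β : ℝ}

theorem weierstrassKernel_eq (K : ℝ → ℂ) (t : ℝ) :
    weierstrassKernel K t = ∫ r in Ioi 0, heatFlux t r • K r := by
  simp only [weierstrassKernel, heatFlux, Complex.real_smul]

/-- The Gaussian moment transform of `K`. -/
def gaussMoment (K : ℝ → ℂ) (l : ℝ) : ℂ := ∫ s in Ioi 0, (s * Real.exp (-l * s ^ 2)) • K s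

theorem mul_gauss_mul_exp_le {a l b s : ℝ} (hal : a ≤ l) (hs : 0 < s) :
    s * Real.exp (-l * s ^ 2) * Real.exp (b * s) ≤ Real.exp (-a * s ^ 2 + (b + 1) * s) := by
  have h1 : s ≤ Real.exp s := by linarith [Real.add_one_le_exp s]
  calc s * Real.exp (-l * s ^ 2) * Real.exp (b * s)
      ≤ Real.exp s * Real.exp (-a * s ^ 2) * Real.exp (b * s) := by gcongr
    _ = _ := by rw [← Real.exp_add, ← Real.exp_add]; ring_nf

theorem integrableOn_gaussMoment (hKm : AEStronglyMeasurable K (volume.restrict (Ioi 0)))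
    (hK : ∀ᵐ t ∂(volume.restrict (Ioi (0 : ℝ))), ‖K t‖ ≤ M * Real.exp (β * t)) {l : ℝ}
    (hl : 0 < l) : IntegrableOn (fun s => (s * Real.exp (-l * s ^ 2)) • K s) (Ioi 0) := by
  refine integrableOn_smul_of_exp_bound hKm hK (Continuous.aestronglyMeasurable (by fun_prop)) ?_
  refine Integrable.mono' (integrable_exp_quadratic hl (β + 1)).integrableOn
    (Continuous.aestronglyMeasurable (by fun_prop)) ?_
  filter_upwards [ae_restrict_mem measurableSet_Ioi] with s (hs : 0 < s)
  rw [Real.norm_of_nonneg (by positivity)]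
  exact mul_gauss_mul_exp_le le_rfl hs

theorem continuousOn_gaussMoment (hM : 0 ≤ M)
    (hKm : AEStronglyMeasurable K (volume.restrict (Ioi 0)))
    (hK : ∀ᵐ t ∂(volume.restrict (Ioi (0 : ℝ))), ‖K t‖ ≤ M * Real.exp (β * t)) :
    ContinuousOn (gaussMoment K) (Ioi 0) := by
  intro l (hl : 0 < l)
  have h : ContinuousOn (gaussMoment K) (Ioi (l / 2)) := by
    refine continuousOn_of_dominated
      (bound := fun s => M * Real.exp (-(l / 2) * s ^ 2 + (β + 1) * s)) ?_ ?_ ?_ ?_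
    · intro l' (hl' : l / 2 < l')
      exact (integrableOn_gaussMoment hKm hK (by linarith)).aestronglyMeasurable
    · intro l' (hl' : l / 2 < l')
      filter_upwards [hK, ae_restrict_mem measurableSet_Ioi] with s hs (hs0 : 0 < s)
      rw [norm_smul, Real.norm_of_nonneg (by positivity)]
      calc s * Real.exp (-l' * s ^ 2) * ‖K s‖
          ≤ s * Real.exp (-l' * s ^ 2) * (M * Real.exp (β * s)) := by gcongr
        _ = M * (s * Real.exp (-l' * s ^ 2) * Real.exp (β * s)) := by ring
        _ ≤ _ := by
          gcongr
          exact mul_gauss_mul_exp_le hl'.le hs0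
    · exact ((integrable_exp_quadratic (by positivity) _).const_mul M).integrableOn
    · exact Eventually.of_forall fun s => Continuous.continuousOn (by fun_prop)
  exact (h.continuousAt (Ioi_mem_nhds (by linarith))).continuousWithinAt

theorem weierstrassKernel_eq_gaussMoment (K : ℝ → ℂ) (t : ℝ) :
    weierstrassKernel K t =
      (1 / (2 * Real.sqrt Real.pi * t ^ (3 / 2 : ℝ))) • gaussMoment K (1 / (4 * t)) := by
  rw [weierstrassKernel_eq, gaussMoment, ← integral_smul]
  congr 1
  ext s
  rw [smul_smul, heatFlux]
  congr 1
  rw [show -(1 / (4 * t)) * s ^ 2 = -s ^ 2 / (4 * t) by ring]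
  ring

theorem ae_eq_zero_of_weierstrassKernel_ae_eq_zero (hM : 0 ≤ M)
    (hKm : AEStronglyMeasurable K (volume.restrict (Ioi 0)))
    (hK : ∀ᵐ t ∂(volume.restrict (Ioi (0 : ℝ))), ‖K t‖ ≤ M * Real.exp (β * t))
    (h : ∀ᵐ t ∂(volume.restrict (Ioi (0 : ℝ))), weierstrassKernel K t = 0) :
    ∀ᵐ t ∂(volume.restrict (Ioi (0 : ℝ))), K t = 0 := by
  have hc : ContinuousOn (fun t => gaussMoment K (1 / (4 * t))) (Ioi 0) := by
    refine (continuousOn_gaussMoment hM hKm hK).comp ?_ ?_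
    · refine ContinuousOn.div continuousOn_const (by fun_prop) fun t (ht : 0 < t) => ?_
      positivity
    · intro t (ht : 0 < t)
      exact mem_Ioi.2 (by positivity)
  -- Continuity upgrades almost everywhere to everywhere, which permits evaluation at the single
  -- points t = 1/(4(n+1)).
  have h0 : EqOn (fun t => gaussMoment K (1 / (4 * t))) 0 (Ioi 0) := by
    refine Measure.eqOn_open_of_ae_eq (μ := volume) ?_ isOpen_Ioi hc continuousOn_const
    filter_upwards [h, ae_restrict_mem measurableSet_Ioi] with t ht (ht0 : 0 < t)
    rw [weierstrassKernel_eq_gaussMoment, smul_eq_zero] at ht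
    refine ht.resolve_left ?_
    positivity
  -- One Gaussian factor goes into G(s) = s e^{-s²} K(s) to make it integrable; hence the nth moment
  -- of G is the Gaussian moment of K at n + 1.
  have h1 := ae_eq_zero_of_integral_gauss_pow (integrableOn_gaussMoment hKm hK one_pos) (by
    intro n
    have hn : (0 : ℝ) < n + 1 := by positivity
    have := h0 (mem_Ioi.2 (by positivity : (0 : ℝ) < 1 / (4 * (n + 1))))
    simp only [Pi.zero_apply] at this
    rw [show 1 / (4 * (1 / (4 * ((n : ℝ) + 1)))) = n + 1 by field_simp, gaussMoment] at this
    rw [← this]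
    congr 1
    ext s
    rw [smul_smul, ← Real.exp_nat_mul, mul_left_comm, ← Real.exp_add]
    ring_nf)
  filter_upwards [h1, ae_restrict_mem measurableSet_Ioi] with s hs (hs0 : 0 < s)
  refine (smul_eq_zero.1 hs).resolve_left ?_
  positivity

theorem isConvolutionFunction_weierstrassKernel (hM : 0 ≤ M) (hK : IsConvolutionFunction K)
    (hKb : ∀ᵐ t ∂(volume.restrict (Ici (0 : ℝ))), ‖K t‖ ≤ M * Real.exp (β * t)) :
    IsConvolutionFunction (weierstrassKernel K) := by
  have hm : AEStronglyMeasurable K (volume.restrict (Ioi 0)) := by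
    rw [restrict_Ioi_eq_restrict_Ici]
    exact hK.locallyIntegrable.aestronglyMeasurable
  rw [← restrict_Ioi_eq_restrict_Ici] at hKb
  refine ⟨?_, fun h => hK.ne_zero ?_⟩
  · intro t ht
    have ht' : 0 < t + 1 := by linarith [mem_Ici.1 ht]
    refine ⟨Icc 0 (t + 1), ?_, ?_⟩
    · rw [← Ici_inter_Iic]
      exact inter_mem_nhdsWithin _ (Iic_mem_nhds (by linarith))
    · rw [integrableOn_Icc_iff_integrableOn_Ioc]
      -- K₁ is the inner integral of a function integrable on (0, t+1] × (0, ∞), so Fubini makes it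
      -- integrable up to 0.
      refine (integrable_heatFlux_time_prod hM hm hKb ht').integral_prod_left.congr ?_
      exact Eventually.of_forall fun τ => (weierstrassKernel_eq K τ).symm
  · rw [← restrict_Ioi_eq_restrict_Ici] at h ⊢
    exact ae_eq_zero_of_weierstrassKernel_ae_eq_zero hM hm hKb h

theorem theta_weierstrassKernel (hM : 0 ≤ M) (hβ : 0 ≤ β)
    (hKm : AEStronglyMeasurable K (volume.restrict (Ioi 0)))
    (hK : ∀ᵐ t ∂(volume.restrict (Ioi (0 : ℝ))), ‖K t‖ ≤ M * Real.exp (β * t)) {t : ℝ}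
    (ht : 0 < t) :
    IntegrableOn (fun s => heatKernel t s • Theta K s) (Ioi 0) ∧
    Theta (weierstrassKernel K) t = ∫ s in Ioi 0, heatKernel t s • Theta K s := by
  have h := integral_integral_heatFlux hM hβ hKm hK ht
  refine ⟨h.1, ?_⟩
  simp only [Theta, weierstrassKernel_eq]
  exact h.2

end Kernel

/-! ### Integration inside the graph of a closed operator. -/

section Graph

variable {E : Type*} [NormedAddCommGroup E] [NormedSpace ℂ E]

theorem mem_graph_iff_exists {A : E →ₗ.[ℂ] E} {x y : E} :
    (x, y) ∈ A.graph ↔ ∃ h : x ∈ A.domain, A ⟨x, h⟩ = y := by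
  rw [LinearPMap.mem_graph_iff]
  constructor
  · rintro ⟨z, hz, hy⟩
    simp only at hz hy
    subst hz
    exact ⟨z.2, hy⟩
  · rintro ⟨h, hy⟩
    exact ⟨⟨x, h⟩, rfl, hy⟩

variable [CompleteSpace E]

/-- The quotient by G is normed because G is closed; the quotient map commutes with the integral and
kills u almost everywhere. -/
theorem integral_mem_of_isClosed {μ : Measure ℝ} {G : Submodule ℂ E} (hG : IsClosed (G : Set E))
    {u : ℝ → E} (hu : Integrable u μ) (h : ∀ᵐ s ∂μ, u s ∈ G) : ∫ s, u s ∂μ ∈ G := by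
  have : IsClosed (G : Set E) := hG
  have h1 := G.mkQL.integral_comp_comm hu
  have h2 : ∫ s, G.mkQL (u s) ∂μ = 0 := by
    refine integral_eq_zero_of_ae ?_
    filter_upwards [h] with s hs
    simpa using hs
  rw [h2] at h1
  simpa using h1.symm

/-- Hille's theorem: the graph is a closed subspace of E × E, and the pair (u, v) is integrated
there. -/
theorem integral_mem_graph {μ : Measure ℝ} {A : E →ₗ.[ℂ] E} (hA : A.IsClosed) {u v : ℝ → E}
    (hu : Integrable u μ) (hv : Integrable v μ) (h : ∀ᵐ s ∂μ, (u s, v s) ∈ A.graph) :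
    (∫ s, u s ∂μ, ∫ s, v s ∂μ) ∈ A.graph := by
  rw [← integral_pair hu hv]
  exact integral_mem_of_isClosed hA (hu.prodMk hv) h

end Graph

/-! ### Strong integrals of operator families. -/

variable {E : Type*} [NormedAddCommGroup E] [NormedSpace ℂ E]

/-- The bounded operator `x ↦ ∫₀^∞ φ(s) T(s) x ds`, when this makes sense. -/
def strongIntegral (T : ℝ → E →L[ℂ] E) (φ : ℝ → ℂ) : E →L[ℂ] E :=
  open Classical in
  if h : (∀ x, IntegrableOn (fun s => φ s • T s x) (Ioi 0)) ∧
      ∃ B, ∀ x, ‖∫ s in Ioi 0, φ s • T s x‖ ≤ B * ‖x‖ then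
    LinearMap.mkContinuousOfExistsBound
      { toFun := fun x => ∫ s in Ioi 0, φ s • T s x
        map_add' := fun x y => by
          simp only [map_add, smul_add]
          exact integral_add (h.1 x) (h.1 y)
        map_smul' := fun c x => by
          simp only [map_smul, smul_comm _ c, RingHom.id_apply]
          exact integral_smul c _ } h.2
  else 0

/-- Continuous scalar functions which are integrable against `exp (b s)` on the half-line. -/
structure ExpIntegrable (b : ℝ) (φ : ℝ → ℂ) : Prop where
  continuous : Continuous φ
  integrable : IntegrableOn (fun s => ‖φ s‖ * Real.exp (b * s)) (Ioi 0)

section StrongIntegral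

variable {T : ℝ → E →L[ℂ] E} {M b : ℝ} {φ : ℝ → ℂ}

theorem aestronglyMeasurable_apply (hT : StronglyContinuous T) (x : E) :
    AEStronglyMeasurable (fun s => T s x) (volume.restrict (Ioi 0)) :=
  ((hT x).mono Ioi_subset_Ici_self).aestronglyMeasurable measurableSet_Ioi

theorem ae_norm_apply_le (hb : ∀ s, 0 ≤ s → ‖T s‖ ≤ M * Real.exp (b * s)) (x : E) :
    ∀ᵐ s ∂(volume.restrict (Ioi (0 : ℝ))), ‖T s x‖ ≤ M * ‖x‖ * Real.exp (b * s) := by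
  filter_upwards [ae_restrict_mem measurableSet_Ioi] with s (hs : 0 < s)
  calc ‖T s x‖ ≤ ‖T s‖ * ‖x‖ := (T s).le_opNorm x
    _ ≤ M * Real.exp (b * s) * ‖x‖ := by gcongr; exact hb s hs.le
    _ = _ := by ring

theorem ae_norm_smul_apply_le (hb : ∀ s, 0 ≤ s → ‖T s‖ ≤ M * Real.exp (b * s)) (φ : ℝ → ℂ)
    (x : E) : ∀ᵐ s ∂(volume.restrict (Ioi (0 : ℝ))),
      ‖φ s • T s x‖ ≤ M * ‖x‖ * (‖φ s‖ * Real.exp (b * s)) := by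
  filter_upwards [ae_norm_apply_le hb x] with s hs
  rw [norm_smul]
  calc ‖φ s‖ * ‖T s x‖ ≤ ‖φ s‖ * (M * ‖x‖ * Real.exp (b * s)) := by gcongr
    _ = _ := by ring

theorem integrableOn_smul_apply (hT : StronglyContinuous T)
    (hb : ∀ s, 0 ≤ s → ‖T s‖ ≤ M * Real.exp (b * s)) (hφ : ExpIntegrable b φ) (x : E) :
    IntegrableOn (fun s => φ s • T s x) (Ioi 0) :=
  Integrable.mono' (hφ.integrable.const_mul (M * ‖x‖))
    (hφ.continuous.aestronglyMeasurable.smul (aestronglyMeasurable_apply hT x))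
    (ae_norm_smul_apply_le hb φ x)

theorem norm_integral_smul_apply_le (hb : ∀ s, 0 ≤ s → ‖T s‖ ≤ M * Real.exp (b * s))
    (hφ : ExpIntegrable b φ) (x : E) : ‖∫ s in Ioi 0, φ s • T s x‖ ≤
      M * (∫ s in Ioi 0, ‖φ s‖ * Real.exp (b * s)) * ‖x‖ := by
  refine (norm_integral_le_of_norm_le (hφ.integrable.const_mul (M * ‖x‖))
    (ae_norm_smul_apply_le hb φ x)).trans_eq ?_
  rw [integral_const_mul]
  ring

theorem strongIntegral_apply (hT : StronglyContinuous T)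
    (hb : ∀ s, 0 ≤ s → ‖T s‖ ≤ M * Real.exp (b * s)) (hφ : ExpIntegrable b φ) (x : E) :
    strongIntegral T φ x = ∫ s in Ioi 0, φ s • T s x := by
  rw [strongIntegral, dif_pos ⟨integrableOn_smul_apply hT hb hφ, _,
    norm_integral_smul_apply_le hb hφ⟩]
  rfl

/-- T is only strongly continuous, so the integral is taken vector by vector; this uniform bound is
what yields estimates in operator norm. -/
theorem norm_strongIntegral_le (hM : 0 ≤ M) (hT : StronglyContinuous T)
    (hb : ∀ s, 0 ≤ s → ‖T s‖ ≤ M * Real.exp (b * s)) (hφ : ExpIntegrable b φ) :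
    ‖strongIntegral T φ‖ ≤ M * ∫ s in Ioi 0, ‖φ s‖ * Real.exp (b * s) := by
  refine ContinuousLinearMap.opNorm_le_bound _ ?_ fun x => ?_
  · exact mul_nonneg hM (integral_nonneg fun s => by positivity)
  · rw [strongIntegral_apply hT hb hφ]
    exact norm_integral_smul_apply_le hb hφ x

theorem ExpIntegrable.sub {ψ : ℝ → ℂ} (hφ : ExpIntegrable b φ) (hψ : ExpIntegrable b ψ) :
    ExpIntegrable b (fun s => φ s - ψ s) := by
  have hφc := hφ.continuous
  have hψc := hψ.continuous
  have hc := hφc.sub hψc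
  refine ⟨hc, Integrable.mono' (hφ.integrable.add hψ.integrable)
    (Continuous.aestronglyMeasurable (by fun_prop)) (Eventually.of_forall fun s => ?_)⟩
  rw [Real.norm_of_nonneg (by positivity), Pi.add_apply, ← add_mul]
  gcongr
  exact norm_sub_le _ _

theorem ExpIntegrable.const_mul (hφ : ExpIntegrable b φ) (c : ℂ) :
    ExpIntegrable b (fun s => c * φ s) := by
  refine ⟨continuous_const.mul hφ.continuous, (hφ.integrable.const_mul ‖c‖).congr
    (Eventually.of_forall fun s => ?_)⟩
  simp only [norm_mul, mul_assoc]

theorem strongIntegral_sub {ψ : ℝ → ℂ} (hT : StronglyContinuous T)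
    (hb : ∀ s, 0 ≤ s → ‖T s‖ ≤ M * Real.exp (b * s))
    (hφ : ExpIntegrable b φ) (hψ : ExpIntegrable b ψ) :
    strongIntegral T (fun s => φ s - ψ s) = strongIntegral T φ - strongIntegral T ψ := by
  ext x
  rw [sub_apply, strongIntegral_apply hT hb (hφ.sub hψ),
    strongIntegral_apply hT hb hφ, strongIntegral_apply hT hb hψ,
    ← integral_sub (integrableOn_smul_apply hT hb hφ x) (integrableOn_smul_apply hT hb hψ x)]
  simp only [sub_smul]

theorem strongIntegral_const_mul (hT : StronglyContinuous T)
    (hb : ∀ s, 0 ≤ s → ‖T s‖ ≤ M * Real.exp (b * s)) (hφ : ExpIntegrable b φ) (c : ℂ) :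
    strongIntegral T (fun s => c * φ s) = c • strongIntegral T φ := by
  ext x
  rw [smul_apply, strongIntegral_apply hT hb (hφ.const_mul c),
    strongIntegral_apply hT hb hφ, ← integral_smul]
  simp only [mul_smul]

end StrongIntegral

/-! ### Operator-norm holomorphy of the Gaussian transform. -/

section Gauss

variable {T : ℝ → E →L[ℂ] E} {M b : ℝ}

/-- The complex Gaussian weight. -/
def gaussWeight (ζ : ℂ) (s : ℝ) : ℂ := Complex.exp (-ζ * ((s ^ 2 / 4 : ℝ) : ℂ))

theorem norm_gaussWeight (ζ : ℂ) (s : ℝ) :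
    ‖gaussWeight ζ s‖ = Real.exp (-(ζ.re / 4) * s ^ 2) := by
  rw [gaussWeight, Complex.norm_exp, Complex.re_mul_ofReal, Complex.neg_re]
  ring_nf

theorem continuous_gaussWeight (ζ : ℂ) : Continuous (gaussWeight ζ) := by
  unfold gaussWeight; fun_prop

theorem expIntegrable_gaussWeight {ζ : ℂ} (hζ : 0 < ζ.re) (b : ℝ) :
    ExpIntegrable b (gaussWeight ζ) := by
  refine ⟨continuous_gaussWeight ζ, ?_⟩
  simp only [norm_gaussWeight, ← Real.exp_add]
  exact (integrable_exp_quadratic (by positivity) b).integrableOn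

theorem sq_div_four_pow_le {s : ℝ} (hs : 0 < s) :
    s ^ 2 / 4 ≤ Real.exp (2 * s) ∧ (s ^ 2 / 4) ^ 2 ≤ Real.exp (4 * s) := by
  have h1 : s ≤ Real.exp s := by linarith [Real.add_one_le_exp s]
  have h2 : s ^ 2 / 4 ≤ Real.exp (2 * s) := calc
    s ^ 2 / 4 ≤ s ^ 2 := by nlinarith [sq_nonneg s]
    _ ≤ Real.exp s ^ 2 := by gcongr
    _ = _ := by rw [← Real.exp_nat_mul]; norm_num
  refine ⟨h2, ?_⟩
  calc (s ^ 2 / 4) ^ 2 ≤ Real.exp (2 * s) ^ 2 := by gcongr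
    _ = _ := by rw [← Real.exp_nat_mul]; congr 1; push_cast; ring

theorem expIntegrable_mul_gaussWeight {ζ : ℂ} (hζ : 0 < ζ.re) (b : ℝ) :
    ExpIntegrable b (fun s => -((s ^ 2 / 4 : ℝ) : ℂ) * gaussWeight ζ s) := by
  have hc := continuous_gaussWeight ζ
  have hc' : Continuous (fun s : ℝ => -((s ^ 2 / 4 : ℝ) : ℂ) * gaussWeight ζ s) := by fun_prop
  refine ⟨hc', Integrable.mono'
    (integrable_exp_quadratic (a := ζ.re / 4) (by positivity) (b + 2)).integrableOn
    (Continuous.aestronglyMeasurable (by fun_prop)) ?_⟩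
  filter_upwards [ae_restrict_mem measurableSet_Ioi] with s (hs : 0 < s)
  rw [Real.norm_of_nonneg (by positivity), norm_mul, norm_neg, Complex.norm_real,
    norm_gaussWeight, Real.norm_of_nonneg (by positivity)]
  calc s ^ 2 / 4 * Real.exp (-(ζ.re / 4) * s ^ 2) * Real.exp (b * s)
      ≤ Real.exp (2 * s) * Real.exp (-(ζ.re / 4) * s ^ 2) * Real.exp (b * s) := by
        gcongr; exact (sq_div_four_pow_le hs).1
    _ = _ := by rw [← Real.exp_add, ← Real.exp_add]; ring_nf

/-- Second-order Taylor remainder of exp at -hs²/4: the size of h lets its exponential consume at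
most half of the Gaussian, and the polynomial factor is absorbed by e^{4s}. -/
theorem norm_gaussWeight_remainder_le {ζ h : ℂ} (hh : ‖h‖ ≤ ζ.re / 2) {s : ℝ} (hs : 0 < s) :
    ‖gaussWeight (ζ + h) s - gaussWeight ζ s -
      h * (-((s ^ 2 / 4 : ℝ) : ℂ) * gaussWeight ζ s)‖ ≤
      ‖h‖ ^ 2 * Real.exp (-(ζ.re / 8) * s ^ 2 + 4 * s) := by
  set q : ℝ := s ^ 2 / 4 with hq
  have hq0 : 0 ≤ q := by positivity
  have e1 : gaussWeight (ζ + h) s - gaussWeight ζ s - h * (-(q : ℂ) * gaussWeight ζ s) =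
      gaussWeight ζ s * (Complex.exp (-h * q) - ∑ m ∈ Finset.range 2, (-h * q) ^ m / m.factorial)
      := by
    have : gaussWeight (ζ + h) s = gaussWeight ζ s * Complex.exp (-h * q) := by
      rw [gaussWeight, gaussWeight, ← Complex.exp_add, ← hq]
      ring_nf
    rw [this]
    simp [Finset.sum_range_succ]
    ring
  have e2 := Complex.norm_exp_sub_sum_le_norm_mul_exp (-h * q) 2
  have e3 : ‖-h * (q : ℂ)‖ = ‖h‖ * q := by
    rw [norm_mul, norm_neg, Complex.norm_real, Real.norm_of_nonneg hq0]
  rw [e3] at e2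
  rw [e1, norm_mul, norm_gaussWeight]
  calc Real.exp (-(ζ.re / 4) * s ^ 2) * _
      ≤ Real.exp (-(ζ.re / 4) * s ^ 2) * ((‖h‖ * q) ^ 2 * Real.exp (‖h‖ * q)) := by gcongr
    _ ≤ Real.exp (-(ζ.re / 4) * s ^ 2) * ((‖h‖ * q) ^ 2 * Real.exp (ζ.re / 2 * q)) := by gcongr
    _ = ‖h‖ ^ 2 * (q ^ 2 * (Real.exp (-(ζ.re / 4) * s ^ 2) * Real.exp (ζ.re / 2 * q))) := by ring
    _ ≤ ‖h‖ ^ 2 * (Real.exp (4 * s) *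
        (Real.exp (-(ζ.re / 4) * s ^ 2) * Real.exp (ζ.re / 2 * q))) := by
      gcongr; exact (sq_div_four_pow_le hs).2
    _ = _ := by
      rw [← Real.exp_add, ← Real.exp_add, hq]
      ring_nf

/-- The Gaussian transform of a strongly continuous exponentially bounded family is
holomorphic for the operator norm. -/
theorem hasDerivAt_strongIntegral_gaussWeight (hM : 0 ≤ M) (hT : StronglyContinuous T)
    (hb : ∀ s, 0 ≤ s → ‖T s‖ ≤ M * Real.exp (b * s)) {ζ : ℂ} (hζ : 0 < ζ.re) :
    HasDerivAt (fun ζ => strongIntegral T (gaussWeight ζ))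
      (strongIntegral T fun s => -((s ^ 2 / 4 : ℝ) : ℂ) * gaussWeight ζ s) ζ := by
  rw [hasDerivAt_iff_isLittleO_nhds_zero]
  refine Asymptotics.IsBigO.trans_isLittleO (g := fun h : ℂ => ‖h‖ ^ 2) ?_
    (Asymptotics.isLittleO_norm_pow_id one_lt_two)
  refine Asymptotics.IsBigO.of_bound
    (M * ∫ s in Ioi 0, Real.exp (-(ζ.re / 8) * s ^ 2 + (b + 4) * s)) ?_
  -- This radius keeps Re(ζ + h) > 0 and respects the bound Re ζ / 2 of the remainder estimate.
  have hball : Metric.closedBall (0 : ℂ) (ζ.re / 3) ∈ 𝓝 (0 : ℂ) :=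
    Metric.closedBall_mem_nhds _ (by positivity)
  filter_upwards [hball] with h hh
  rw [mem_closedBall_zero_iff] at hh
  have hre : 0 < (ζ + h).re := by
    have := (abs_le.1 (Complex.abs_re_le_norm h)).1
    rw [Complex.add_re]
    linarith
  have h1 := expIntegrable_gaussWeight hre b
  have h2 := expIntegrable_gaussWeight hζ b
  have h3 := expIntegrable_mul_gaussWeight hζ b
  rw [← strongIntegral_const_mul hT hb h3, ← strongIntegral_sub hT hb h1 h2,
    ← strongIntegral_sub hT hb (h1.sub h2) (h3.const_mul h)]
  have h4 := (h1.sub h2).sub (h3.const_mul h)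
  refine (norm_strongIntegral_le hM hT hb h4).trans ?_
  rw [norm_pow, norm_norm, mul_assoc, ← integral_mul_const]
  refine mul_le_mul_of_nonneg_left ?_ hM
  refine setIntegral_mono_on h4.integrable
    ((integrable_exp_quadratic (by positivity) _).mul_const _).integrableOn
    measurableSet_Ioi fun s hs => ?_
  calc _ ≤ ‖h‖ ^ 2 * Real.exp (-(ζ.re / 8) * s ^ 2 + 4 * s) * Real.exp (b * s) := by
        gcongr
        exact norm_gaussWeight_remainder_le (by linarith) hs
    _ = _ := by rw [mul_assoc, ← Real.exp_add]; ring_nf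

end Gauss

/-! ### Sector geometry. -/

theorem mem_sector_pi_div_two {z : ℂ} : z ∈ sector (Real.pi / 2) ↔ 0 < z.re := by
  simp only [sector, mem_ofPred_eq, Complex.abs_arg_lt_pi_div_two_iff]
  constructor
  · rintro ⟨h0, h | h⟩
    · exact h
    · exact absurd h h0
  · intro h
    refine ⟨?_, Or.inl h⟩
    rintro rfl
    simp at h

theorem isOpen_sector_pi_div_two : IsOpen (sector (Real.pi / 2)) := by
  have : sector (Real.pi / 2) = {z : ℂ | 0 < z.re} := by
    ext z; exact mem_sector_pi_div_two
  rw [this]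
  exact isOpen_lt continuous_const Complex.continuous_re

theorem norm_mul_cos_le_re_of_mem_sector {γ : ℝ} (hγ : γ < Real.pi / 2) {z : ℂ}
    (hz : z ∈ sector γ) : ‖z‖ * Real.cos γ ≤ z.re := by
  rw [← Complex.norm_mul_cos_arg z, ← Real.cos_abs z.arg]
  gcongr
  exact Real.cos_le_cos_of_nonneg_of_le_pi (abs_nonneg _) (by linarith [Real.pi_pos]) hz.2.le

theorem div_norm_le_re_inv_of_mem_sector {γ : ℝ} (hγ : γ < Real.pi / 2) {z : ℂ}
    (hz : z ∈ sector γ) : Real.cos γ / ‖z‖ ≤ (z⁻¹).re := by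
  have h0 : 0 < ‖z‖ := norm_pos_iff.2 hz.1
  rw [Complex.inv_re, Complex.normSq_eq_norm_sq, div_le_div_iff₀ h0 (by positivity)]
  nlinarith [norm_mul_cos_le_re_of_mem_sector hγ hz]

/-! ### The heat transform in sectors: analyticity, growth, limit at 0. -/

/-- The heat transform `(π z)^{-1/2} ∫₀^∞ exp (-s² / 4z) T(s) ds` of the family `T`. -/
def heatTransform (T : ℝ → E →L[ℂ] E) (z : ℂ) : E →L[ℂ] E :=
  ((Real.pi : ℂ) * z) ^ ((-(1 / 2) : ℝ) : ℂ) • strongIntegral T (gaussWeight z⁻¹)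

section

variable {T : ℝ → E →L[ℂ] E} {M b : ℝ}

theorem analyticOnNhd_heatTransform [CompleteSpace E] (hM : 0 ≤ M) (hT : StronglyContinuous T)
    (hb : ∀ s, 0 ≤ s → ‖T s‖ ≤ M * Real.exp (b * s)) :
    AnalyticOnNhd ℂ (heatTransform T) (sector (Real.pi / 2)) := by
  refine DifferentiableOn.analyticOnNhd (fun z hz => ?_) isOpen_sector_pi_div_two
  have hre := mem_sector_pi_div_two.1 hz
  have hz0 : z ≠ 0 := hz.1
  have hinv : 0 < (z⁻¹).re := by
    rw [Complex.inv_re]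
    exact div_pos hre (Complex.normSq_pos.2 hz0)
  have h1 : DifferentiableAt ℂ (fun z => strongIntegral T (gaussWeight z⁻¹)) z :=
    DifferentiableAt.comp (g := fun ζ => strongIntegral T (gaussWeight ζ)) z
      (hasDerivAt_strongIntegral_gaussWeight hM hT hb hinv).differentiableAt
      (differentiableAt_inv hz0)
  have h2 : DifferentiableAt ℂ (fun z : ℂ => ((Real.pi : ℂ) * z) ^ ((-(1 / 2) : ℝ) : ℂ)) z := by
    -- Positive real part keeps πz off the branch cut of the principal power.
    refine DifferentiableAt.cpow (by fun_prop) (by fun_prop) (Or.inl ?_)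
    rw [Complex.re_ofReal_mul]
    have := Real.pi_pos
    positivity
  exact (h2.smul h1).differentiableWithinAt

theorem heatTransform_ofReal (hT : StronglyContinuous T)
    (hb : ∀ s, 0 ≤ s → ‖T s‖ ≤ M * Real.exp (b * s)) {t : ℝ} (ht : 0 < t) (x : E) :
    heatTransform T t x = (1 / Real.sqrt (Real.pi * t)) •
      ∫ s in Ioi 0, Real.exp (-s ^ 2 / (4 * t)) • T s x := by
  have hre : 0 < ((t : ℂ)⁻¹).re := by
    rw [← Complex.ofReal_inv, Complex.ofReal_re]
    positivity
  rw [heatTransform, smul_apply, strongIntegral_apply hT hb (expIntegrable_gaussWeight hre b),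
    ← Complex.ofReal_mul, ← Complex.ofReal_cpow (by have := Real.pi_pos; positivity),
    Complex.coe_smul, Real.rpow_neg (by have := Real.pi_pos; positivity), ← Real.sqrt_eq_rpow,
    one_div]
  congr 2
  ext s
  rw [← Complex.coe_smul, gaussWeight, ← Complex.ofReal_inv, ← Complex.ofReal_neg,
    ← Complex.ofReal_mul, ← Complex.ofReal_exp]
  congr 3
  field_simp

/-- The scale-invariant majorant of the heat transform in a sector. -/
def gaussMean (T : ℝ → E →L[ℂ] E) (a ρ : ℝ) (x : E) : ℝ :=
  1 / Real.sqrt Real.pi * ∫ v in Ioi (0 : ℝ), Real.exp (-a * v ^ 2) * ‖T (ρ * v) x‖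

/-- Since Re(1/z) ≥ cos γ/|z|, substituting s = √|z| v cancels the prefactor |z|^{-1/2} and removes
z from the Gaussian; z survives only as a dilation of T. -/
theorem norm_heatTransform_apply_le (hT : StronglyContinuous T)
    (hb : ∀ s, 0 ≤ s → ‖T s‖ ≤ M * Real.exp (b * s)) {γ : ℝ} (hγ0 : 0 < γ)
    (hγ : γ < Real.pi / 2) {z : ℂ} (hz : z ∈ sector γ) (x : E) :
    ‖heatTransform T z x‖ ≤ gaussMean T (Real.cos γ / 4) (Real.sqrt ‖z‖) x := by
  have h0 : 0 < ‖z‖ := norm_pos_iff.2 hz.1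
  have hcos : 0 < Real.cos γ := Real.cos_pos_of_mem_Ioo ⟨by linarith [Real.pi_pos], hγ⟩
  have hinv := div_norm_le_re_inv_of_mem_sector hγ hz
  have hre : 0 < (z⁻¹).re := lt_of_lt_of_le (by positivity) hinv
  have hρ : 0 < Real.sqrt ‖z‖ := Real.sqrt_pos.2 h0
  have hnorm : ‖((Real.pi : ℂ) * z) ^ ((-(1 / 2) : ℝ) : ℂ)‖ =
      1 / Real.sqrt Real.pi * (Real.sqrt ‖z‖)⁻¹ := by
    rw [Complex.norm_cpow_real, norm_mul, Complex.norm_real,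
      Real.norm_of_nonneg Real.pi_pos.le, Real.rpow_neg (by positivity), ← Real.sqrt_eq_rpow,
      Real.sqrt_mul Real.pi_pos.le, mul_inv, one_div]
  have hsub := integral_comp_mul_left_Ioi
    (fun s => Real.exp (-(Real.cos γ / ‖z‖ / 4) * s ^ 2) * ‖T s x‖) 0 hρ
  have he : ∀ v : ℝ, -(Real.cos γ / ‖z‖ / 4) * (Real.sqrt ‖z‖ * v) ^ 2 =
      -(Real.cos γ / 4) * v ^ 2 := by
    intro v
    rw [mul_pow, Real.sq_sqrt h0.le]
    field_simp
  simp only [he, mul_zero, smul_eq_mul] at hsub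
  rw [heatTransform, smul_apply, norm_smul, hnorm, gaussMean, hsub, mul_assoc,
    strongIntegral_apply hT hb (expIntegrable_gaussWeight hre b)]
  gcongr
  refine norm_integral_le_of_norm_le ?_ ?_
  · have hI : IntegrableOn (fun s => Real.exp (-(Real.cos γ / ‖z‖ / 4) * s ^ 2) • T s x)
        (Ioi 0) := by
      refine integrableOn_smul_of_exp_bound (aestronglyMeasurable_apply hT x)
        (ae_norm_apply_le hb x) (Continuous.aestronglyMeasurable (by fun_prop)) ?_
      simp only [← Real.exp_add]
      exact (integrable_exp_quadratic (by positivity) b).integrableOn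
    refine hI.norm.congr (Eventually.of_forall fun s => ?_)
    simp only [norm_smul, Real.norm_eq_abs, Real.abs_exp]
  · refine Eventually.of_forall fun s => ?_
    rw [norm_smul, norm_gaussWeight]
    gcongr

theorem norm_apply_scaled_le (hb : ∀ s, 0 ≤ s → ‖T s‖ ≤ M * Real.exp (b * s))
    {ρ v : ℝ} (hρ : 0 ≤ ρ) (hv : 0 ≤ v) (x : E) :
    ‖T (ρ * v) x‖ ≤ M * ‖x‖ * Real.exp (b * ρ * v) := by
  calc ‖T (ρ * v) x‖ ≤ ‖T (ρ * v)‖ * ‖x‖ := (T _).le_opNorm x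
    _ ≤ M * Real.exp (b * (ρ * v)) * ‖x‖ := by gcongr; exact hb _ (by positivity)
    _ = _ := by ring_nf

/-- Half of the Gaussian pays for e^{bρv} by completing the square. The cost is exponential in ρ²,
hence in |z| when ρ = √|z|. -/
theorem gaussMean_le (hM : 0 ≤ M) (hb : ∀ s, 0 ≤ s → ‖T s‖ ≤ M * Real.exp (b * s)) {a ρ : ℝ}
    (ha : 0 < a) (hρ : 0 ≤ ρ) (x : E) :
    gaussMean T a ρ x ≤ 1 / Real.sqrt Real.pi *
      (M * (∫ v in Ioi (0 : ℝ), Real.exp (-(a / 2) * v ^ 2)) *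
        Real.exp (b ^ 2 / (2 * a) * ρ ^ 2)) * ‖x‖ := by
  rw [gaussMean, mul_assoc]
  gcongr
  rw [← integral_const_mul, ← integral_mul_const, ← integral_mul_const]
  have hi : Integrable fun v : ℝ => Real.exp (-(a / 2) * v ^ 2) :=
    integrable_exp_neg_mul_sq (by positivity)
  refine integral_mono_of_nonneg (Eventually.of_forall fun v => by positivity)
    ((((hi.const_mul M).mul_const _).mul_const ‖x‖).integrableOn) ?_
  filter_upwards [ae_restrict_mem measurableSet_Ioi] with v (hv : 0 < v)
  have hexp : Real.exp (-a * v ^ 2) * Real.exp (b * ρ * v) ≤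
      Real.exp (-(a / 2) * v ^ 2) * Real.exp (b ^ 2 / (2 * a) * ρ ^ 2) := by
    rw [← Real.exp_add, ← Real.exp_add, Real.exp_le_exp]
    have h : 0 ≤ (a * v - b * ρ) ^ 2 / (2 * a) := by positivity
    have : (a * v - b * ρ) ^ 2 / (2 * a) =
        (-(a / 2) * v ^ 2 + b ^ 2 / (2 * a) * ρ ^ 2) - (-a * v ^ 2 + b * ρ * v) := by
      field_simp
      ring
    linarith
  calc Real.exp (-a * v ^ 2) * ‖T (ρ * v) x‖
      ≤ Real.exp (-a * v ^ 2) * (M * ‖x‖ * Real.exp (b * ρ * v)) := by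
        gcongr; exact norm_apply_scaled_le hb hρ hv.le x
    _ = M * ‖x‖ * (Real.exp (-a * v ^ 2) * Real.exp (b * ρ * v)) := by ring
    _ ≤ M * ‖x‖ * (Real.exp (-(a / 2) * v ^ 2) * Real.exp (b ^ 2 / (2 * a) * ρ ^ 2)) := by
        gcongr
    _ = _ := by ring

/-- Dominated convergence: T(ρv)x → T(0)x = 0 for each v, with a majorant uniform in ρ ≤ 1. -/
theorem tendsto_gaussMean (hM : 0 ≤ M) (hb0 : 0 ≤ b) (hT : StronglyContinuous T)
    (hb : ∀ s, 0 ≤ s → ‖T s‖ ≤ M * Real.exp (b * s)) (hT0 : T 0 = 0) {a : ℝ} (ha : 0 < a)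
    (x : E) : Tendsto (fun ρ => gaussMean T a ρ x) (𝓝[≥] 0) (𝓝 0) := by
  have hlim : Tendsto
      (fun ρ => ∫ v in Ioi (0 : ℝ), Real.exp (-a * v ^ 2) * ‖T (ρ * v) x‖) (𝓝[≥] 0)
      (𝓝 (∫ v in Ioi (0 : ℝ), (0 : ℝ))) := by
    refine tendsto_integral_filter_of_dominated_convergence
      (fun v => M * ‖x‖ * Real.exp (-a * v ^ 2 + b * v)) ?_ ?_ ?_ ?_
    · filter_upwards [self_mem_nhdsWithin] with ρ (hρ : 0 ≤ ρ)
      refine ContinuousOn.aestronglyMeasurable (ContinuousOn.mul (by fun_prop) ?_)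
        measurableSet_Ioi
      refine ((hT x).comp (f := fun v => ρ * v) (by fun_prop) ?_).norm
      intro v (hv : 0 < v)
      exact mem_Ici.2 (by positivity)
    · filter_upwards [self_mem_nhdsWithin, nhdsWithin_le_nhds (Iic_mem_nhds one_pos)]
        with ρ (hρ : 0 ≤ ρ) (hρ1 : ρ ≤ 1)
      filter_upwards [ae_restrict_mem measurableSet_Ioi] with v (hv : 0 < v)
      rw [Real.norm_of_nonneg (by positivity), Real.exp_add]
      calc Real.exp (-a * v ^ 2) * ‖T (ρ * v) x‖
          ≤ Real.exp (-a * v ^ 2) * (M * ‖x‖ * Real.exp (b * ρ * v)) := by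
            gcongr; exact norm_apply_scaled_le hb hρ hv.le x
        _ ≤ Real.exp (-a * v ^ 2) * (M * ‖x‖ * Real.exp (b * 1 * v)) := by gcongr
        _ = _ := by ring_nf
    · exact ((integrable_exp_quadratic ha b).const_mul _).integrableOn
    · filter_upwards [ae_restrict_mem measurableSet_Ioi] with v (hv : 0 < v)
      have h1 : Tendsto (fun ρ => ρ * v) (𝓝[≥] 0) (𝓝[≥] 0) := by
        refine tendsto_nhdsWithin_iff.2 ⟨?_, ?_⟩
        · have : Continuous fun ρ : ℝ => ρ * v := by fun_prop
          simpa using (this.tendsto 0).mono_left nhdsWithin_le_nhds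
        · filter_upwards [self_mem_nhdsWithin] with ρ (hρ : 0 ≤ ρ)
          exact mem_Ici.2 (by positivity)
      have h2 : Tendsto (fun s => T s x) (𝓝[≥] 0) (𝓝 (T 0 x)) := hT x 0 (mem_Ici.2 le_rfl)
      have h3 := ((h2.comp h1).norm).const_mul (Real.exp (-a * v ^ 2))
      rw [hT0, zero_apply, norm_zero, mul_zero] at h3
      exact h3
  simpa [gaussMean] using hlim.const_mul (1 / Real.sqrt Real.pi)

theorem tendsto_heatTransform (hM : 0 ≤ M) (hb0 : 0 ≤ b) (hT : StronglyContinuous T)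
    (hb : ∀ s, 0 ≤ s → ‖T s‖ ≤ M * Real.exp (b * s)) (hT0 : T 0 = 0) {γ : ℝ} (hγ0 : 0 < γ)
    (hγ : γ < Real.pi / 2) (x : E) :
    Tendsto (fun z => heatTransform T z x) (𝓝[sector γ] (0 : ℂ)) (𝓝 (0 : E)) := by
  have hcos : 0 < Real.cos γ := Real.cos_pos_of_mem_Ioo ⟨by linarith [Real.pi_pos], hγ⟩
  have h1 : Tendsto (fun z : ℂ => Real.sqrt ‖z‖) (𝓝[sector γ] 0) (𝓝[≥] 0) := by
    refine tendsto_nhdsWithin_iff.2 ⟨?_, Eventually.of_forall fun z => Real.sqrt_nonneg _⟩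
    have : Continuous fun z : ℂ => Real.sqrt ‖z‖ := by fun_prop
    simpa using (this.tendsto 0).mono_left nhdsWithin_le_nhds
  refine squeeze_zero_norm' ?_ ((tendsto_gaussMean hM hb0 hT hb hT0
    (by positivity : 0 < Real.cos γ / 4) x).comp h1)
  filter_upwards [self_mem_nhdsWithin] with z hz
  exact norm_heatTransform_apply_le hT hb hγ0 hγ hz x

theorem exists_norm_heatTransform_le (hM : 0 ≤ M) (hT : StronglyContinuous T)
    (hb : ∀ s, 0 ≤ s → ‖T s‖ ≤ M * Real.exp (b * s)) {γ : ℝ} (hγ0 : 0 < γ)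
    (hγ : γ < Real.pi / 2) :
    ∃ M' : ℝ, 0 < M' ∧ ∃ ω : ℝ, 0 < ω ∧
      ∀ z ∈ sector γ, ‖heatTransform T z‖ ≤ M' * Real.exp (ω * z.re) := by
  have hcos : 0 < Real.cos γ := Real.cos_pos_of_mem_Ioo ⟨by linarith [Real.pi_pos], hγ⟩
  set a := Real.cos γ / 4 with ha_def
  have ha : 0 < a := by positivity
  set I := ∫ v in Ioi (0 : ℝ), Real.exp (-(a / 2) * v ^ 2)
  have hI : 0 ≤ I := integral_nonneg fun v => by positivity
  -- The rate converts |z| into Re z through |z| ≤ Re z / cos γ; each + 1 only secures strict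
  -- positivity.
  refine ⟨1 / Real.sqrt Real.pi * (M * I) + 1, by positivity,
    b ^ 2 / (2 * a) / Real.cos γ + 1, by positivity, fun z hz => ?_⟩
  have hzre := norm_mul_cos_le_re_of_mem_sector hγ hz
  have hre : 0 ≤ z.re := le_trans (by positivity) hzre
  refine ContinuousLinearMap.opNorm_le_bound _ (by positivity) fun x => ?_
  refine (norm_heatTransform_apply_le hT hb hγ0 hγ hz x).trans ?_
  refine (gaussMean_le hM hb ha (Real.sqrt_nonneg _) x).trans ?_
  rw [Real.sq_sqrt (norm_nonneg z)]
  have hexp : b ^ 2 / (2 * a) * ‖z‖ ≤ (b ^ 2 / (2 * a) / Real.cos γ + 1) * z.re := by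
    have : ‖z‖ ≤ z.re / Real.cos γ := (le_div_iff₀ hcos).2 hzre
    calc b ^ 2 / (2 * a) * ‖z‖ ≤ b ^ 2 / (2 * a) * (z.re / Real.cos γ) := by gcongr
      _ = b ^ 2 / (2 * a) / Real.cos γ * z.re := by ring
      _ ≤ _ := by gcongr; linarith
  calc 1 / Real.sqrt Real.pi * (M * I * Real.exp (b ^ 2 / (2 * a) * ‖z‖)) * ‖x‖
      = 1 / Real.sqrt Real.pi * (M * I) * Real.exp (b ^ 2 / (2 * a) * ‖z‖) * ‖x‖ := by ring
    _ ≤ (1 / Real.sqrt Real.pi * (M * I) + 1) *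
        Real.exp ((b ^ 2 / (2 * a) / Real.cos γ + 1) * z.re) * ‖x‖ := by
      gcongr
      linarith

end

/-! ### The convoluted semigroup identities. -/

section Semigroup

/-- The restriction of the heat transform to the positive half-line, extended by zero. -/
def heatSemigroup (T : ℝ → E →L[ℂ] E) (t : ℝ) : E →L[ℂ] E :=
  if 0 < t then heatTransform T t else 0

variable {T : ℝ → E →L[ℂ] E} {M b : ℝ}

theorem heatSemigroup_apply (hT : StronglyContinuous T)
    (hb : ∀ s, 0 ≤ s → ‖T s‖ ≤ M * Real.exp (b * s)) {t : ℝ} (ht : 0 ≤ t) (x : E) :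
    heatSemigroup T t x = ∫ s in Ioi 0, heatKernel t s • T s x := by
  rcases ht.eq_or_lt with rfl | ht
  · simp [heatSemigroup]
  · rw [heatSemigroup, if_pos ht, heatTransform_ofReal hT hb ht, ← integral_smul]
    simp only [smul_smul, heatKernel]

theorem integrableOn_heatKernel_smul (hT : StronglyContinuous T)
    (hb : ∀ s, 0 ≤ s → ‖T s‖ ≤ M * Real.exp (b * s)) {t : ℝ} (ht : 0 ≤ t) (x : E) :
    IntegrableOn (fun s => heatKernel t s • T s x) (Ioi 0) := by
  rcases ht.eq_or_lt with rfl | ht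
  · simp
  · exact integrableOn_smul_of_exp_bound (aestronglyMeasurable_apply hT x)
      (ae_norm_apply_le hb x) (continuous_heatKernel t).aestronglyMeasurable
      (integrable_heatKernel_mul_exp ht b).integrableOn

theorem stronglyContinuous_heatSemigroup [CompleteSpace E] (hM : 0 ≤ M) (hb0 : 0 ≤ b)
    (hT : StronglyContinuous T) (hb : ∀ s, 0 ≤ s → ‖T s‖ ≤ M * Real.exp (b * s))
    (hT0 : T 0 = 0) : StronglyContinuous (heatSemigroup T) := by
  intro x t (ht : 0 ≤ t)
  rcases ht.eq_or_lt with rfl | ht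
  · rw [← continuousWithinAt_Ioi_iff_Ici, ContinuousWithinAt]
    have hpi := Real.pi_pos
    -- Continuity at 0 is the sectorial limit along the positive axis; any angle in (0, π/2) would
    -- serve.
    have h1 : Tendsto (fun t : ℝ => (t : ℂ)) (𝓝[>] 0) (𝓝[sector (Real.pi / 4)] 0) := by
      refine tendsto_nhdsWithin_iff.2 ⟨?_, ?_⟩
      · simpa using (Complex.continuous_ofReal.tendsto 0).mono_left nhdsWithin_le_nhds
      · filter_upwards [self_mem_nhdsWithin] with t (ht : 0 < t)
        refine ⟨Complex.ofReal_ne_zero.2 ht.ne', ?_⟩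
        rw [Complex.arg_ofReal_of_nonneg ht.le, abs_zero]
        positivity
    have h2 := (tendsto_heatTransform hM hb0 hT hb hT0 (by positivity : 0 < Real.pi / 4)
      (by linarith) x).comp h1
    rw [show heatSemigroup T 0 x = 0 by simp [heatSemigroup]]
    refine h2.congr' ?_
    filter_upwards [self_mem_nhdsWithin] with t (ht : 0 < t)
    simp only [Function.comp_apply, heatSemigroup, if_pos ht]
  · have h1 : ContinuousAt (heatTransform T) (t : ℂ) :=
      (analyticOnNhd_heatTransform hM hT hb (t : ℂ)
        (mem_sector_pi_div_two.2 (by simpa using ht))).continuousAt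
    have h2 : ContinuousAt (fun t : ℝ => heatTransform T (t : ℂ) x) t :=
      (ContinuousAt.comp (f := fun t : ℝ => (t : ℂ)) h1
        Complex.continuous_ofReal.continuousAt).clm_apply continuousAt_const
    refine (h2.congr ?_).continuousWithinAt
    filter_upwards [lt_mem_nhds ht] with τ hτ
    simp only [heatSemigroup, if_pos hτ]

/-- At t = 0 both the integral and Θ vanish in the defining identity. -/
theorem IsCosineFunction.apply_zero {A : E →ₗ.[ℂ] E} {C : E →L[ℂ] E} {K : ℝ → ℂ}
    (h : IsCosineFunction A C K T) : T 0 = 0 := by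
  ext x
  obtain ⟨hx, he⟩ := h.integral_eq 0 le_rfl x
  have h0 : (⟨_, hx⟩ : A.domain) = 0 := Subtype.ext (by simp)
  rw [h0, A.map_zero] at he
  simpa [Theta] using he.symm

/-- The heat transform carries convoluted cosine functions to convoluted semigroups. -/
theorem IsCosineFunction.isSemigroup_heatSemigroup [CompleteSpace E] {A : E →ₗ.[ℂ] E}
    {C : E →L[ℂ] E} {K : ℝ → ℂ} {MK β : ℝ} (h : IsCosineFunction A C K T) (hMK : 0 ≤ MK)
    (hβ : 0 ≤ β)
    (hK : ∀ᵐ t ∂(volume.restrict (Ici (0 : ℝ))), ‖K t‖ ≤ MK * Real.exp (β * t))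
    (hM : 0 ≤ M) (hb0 : 0 ≤ b) (hb : ∀ s, 0 ≤ s → ‖T s‖ ≤ M * Real.exp (b * s)) :
    IsSemigroup A C (weierstrassKernel K) (heatSemigroup T) where
  closed := h.closed
  kernel := isConvolutionFunction_weierstrassKernel hMK h.kernel hK
  strongly_continuous :=
    stronglyContinuous_heatSemigroup hM hb0 h.strongly_continuous hb h.apply_zero
  commutes_gen t ht x := by
    have hT := h.strongly_continuous
    rw [← mem_graph_iff_exists, heatSemigroup_apply hT hb ht, heatSemigroup_apply hT hb ht]
    refine integral_mem_graph h.closed (integrableOn_heatKernel_smul hT hb ht _)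
      (integrableOn_heatKernel_smul hT hb ht _) ?_
    filter_upwards [ae_restrict_mem measurableSet_Ioi] with s (hs : 0 < s)
    exact A.graph.smul_of_tower_mem (heatKernel t s)
      (mem_graph_iff_exists.2 (h.commutes_gen s hs.le x))
  commutes_C t ht x := by
    have hT := h.strongly_continuous
    rw [heatSemigroup_apply hT hb ht, heatSemigroup_apply hT hb ht,
      ← C.integral_comp_comm (integrableOn_heatKernel_smul hT hb ht x)]
    refine setIntegral_congr_fun measurableSet_Ioi fun s (hs : 0 < s) => ?_
    simp only [h.commutes_C s hs.le, C.map_smul_of_tower]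
  integral_eq t ht x := by
    have hT := h.strongly_continuous
    rw [← mem_graph_iff_exists]
    rcases ht.eq_or_lt with rfl | ht
    · simp [heatSemigroup, Theta]
    have hKm : AEStronglyMeasurable K (volume.restrict (Ioi 0)) := by
      rw [restrict_Ioi_eq_restrict_Ici]
      exact h.kernel.locallyIntegrable.aestronglyMeasurable
    rw [← restrict_Ioi_eq_restrict_Ici] at hK
    obtain ⟨hw, hS⟩ := integral_integral_heatKernel (by positivity) hb0
      (aestronglyMeasurable_apply hT x) (ae_norm_apply_le hb x) ht
    obtain ⟨hθ, hΘ⟩ := theta_weierstrassKernel hMK hβ hKm hK ht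
    have hS' : ∫ s in (0 : ℝ)..t, heatSemigroup T s x =
        ∫ s in Ioi 0, heatKernel t s • ∫ r in (0 : ℝ)..s, (s - r) • T r x := by
      rw [← hS]
      refine intervalIntegral.integral_congr fun τ hτ => ?_
      rw [uIcc_of_le ht.le] at hτ
      exact heatSemigroup_apply hT hb hτ.1 x
    have hi1 := integrableOn_heatKernel_smul hT hb ht.le x
    have hi2 := hθ.smul_const (C x)
    have hS2 : heatSemigroup T t x - Theta (weierstrassKernel K) t • C x =
        ∫ s in Ioi 0, heatKernel t s • (T s x - Theta K s • C x) := by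
      rw [heatSemigroup_apply hT hb ht.le, hΘ, ← integral_smul_const, ← integral_sub hi1 hi2]
      simp only [smul_sub, smul_assoc]
    rw [hS', hS2]
    -- Both sides are now heat transforms, so the cosine identity at each s, scaled by p(t,s), is
    -- integrated inside the graph of A.
    refine integral_mem_graph h.closed hw ?_ ?_
    · refine (hi1.sub hi2).congr (Eventually.of_forall fun s => ?_)
      simp only [Pi.sub_apply, smul_sub, smul_assoc]
    · filter_upwards [ae_restrict_mem measurableSet_Ioi] with s (hs : 0 < s)
      exact A.graph.smul_of_tower_mem (heatKernel t s)
        (mem_graph_iff_exists.2 (h.integral_eq s hs.le x))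

end Semigroup

end Convoluted

end

theorem theorem10 {E : Type*} [NormedAddCommGroup E] [NormedSpace ℂ E] [CompleteSpace E]
    (A : E →ₗ.[ℂ] E) (C : E →L[ℂ] E) (hC : Function.Injective C)
    (K : ℝ → ℂ) (M β : ℝ) (hM : 0 < M) (hβ : 0 < β)
    (hK : ∀ᵐ t ∂(volume.restrict (Ici (0 : ℝ))), ‖K t‖ ≤ M * Real.exp (β * t))
    (CK : ℝ → E →L[ℂ] E) (hCK : Convoluted.IsCosineFunction A C K CK)
    (hbdd : Convoluted.ExponentiallyBounded CK) :
    ∃ S : ℝ → E →L[ℂ] E,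
      S 0 = 0 ∧
      (∀ t : ℝ, 0 < t → ∀ x : E,
        S t x = (1 / Real.sqrt (Real.pi * t)) •
          ∫ s in Ioi (0 : ℝ), Real.exp (-s ^ 2 / (4 * t)) • CK s x) ∧
      Convoluted.IsExpBoundedAnalyticSemigroup A C (Convoluted.weierstrassKernel K) S
        (Real.pi / 2) := by
  obtain ⟨M', hM', ω, hω⟩ := hbdd
  have hT := hCK.strongly_continuous
  -- The Fubini and limit arguments need a nonnegative growth rate.
  have hb : ∀ s, 0 ≤ s → ‖CK s‖ ≤ M' * Real.exp (|ω| * s) := fun s hs =>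
    (hω s hs).trans (by gcongr; exact le_abs_self ω)
  have hpos : ∀ t : ℝ, 0 < t →
      Convoluted.heatSemigroup CK t = Convoluted.heatTransform CK t := fun t ht => if_pos ht
  refine ⟨Convoluted.heatSemigroup CK, if_neg (lt_irrefl 0), fun t ht x => ?_, ?_⟩
  · rw [hpos t ht, Convoluted.heatTransform_ofReal hT hb ht]
  · exact
      { angle_pos := by positivity
        angle_le := le_rfl
        semigroup := hCK.isSemigroup_heatSemigroup hM.le hβ.le hK hM'.le (abs_nonneg ω) hb
        extension := ⟨Convoluted.heatTransform CK,
          Convoluted.analyticOnNhd_heatTransform hM'.le hT hb, fun t ht => (hpos t ht).symm,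
          fun γ h0 h1 x => Convoluted.tendsto_heatTransform hM'.le (abs_nonneg ω) hT hb
            hCK.apply_zero h0 h1 x,
          fun γ h0 h1 => Convoluted.exists_norm_heatTransform_le hM'.le hT hb h0 h1⟩ }
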